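/- **Setting.** Let $\varphi:(0,+\infty)\to(0,+\infty)$ satisfy: (i) $\varphi\in C^1((0,+\infty))$; (ii) $(s\varphi(s))'>0$ for all $s>0$; (iii) the range of $s\mapsto s\varphi(s)$ is $(0,+\infty)$; (iv) there are $C_1,C_2>0$, $r>-1$ and $s_0>0$ with $C_1s^r\le (s\varphi(s))'\le C_2s^r$ for $s\in(0,s_0)$; if $r=0$, moreover the finite limit $\lim_{s\to0^+}\varphi(s)>0$ exists and $\lim_{s\to0^+}s\varphi'(s)=0$; (v) there is $s_1>s_0$ such that either $\varphi'\ge0$ on $[s_1,+\infty)$ or $\varphi'\le 0$ on $[s_1,+\infty)$; (vi) $s\mapsto|s\varphi'(s)/\varphi(s)|$ is non-decreasing on $(0,+\infty)$. Define $\Lambda:(0,+\infty)\to\mathbb R$ by $$\Lambda\big(s\sqrt{\varphi(s)}\big)=-\frac{s\varphi'(s)}{s\varphi'(s)+2\varphi(s)}\qquad(s>0),$$ and $\Lambda_\infty^2=\sup_{t>0}\Lambda^2(t)$. Let $(a,b)\subset\mathbb R$ be a bounded or unbounded open interval, let $\mathscr A(x)=\{a_{ij}(x)\}$ be an $m\times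 m$ matrix with complex entries in $L^1_{\rm loc}((a,b))$, and let $Au=(\mathscr A(x)u')'$. Write $\langle\cdot,\cdot\rangle$ for the Hermitian product on $\mathbb C^m$, and $\mathring C^1$ for the space of $\mathbb C^m$-valued $C^1$ functions with compact support in $(a,b)$. Expressions $\varphi(|u|)u$ and $\sqrt{\varphi(|u|)}\,u$ are $0$ where $u=0$. * $A$ is *$L^\Phi$-dissipative* if $\Re\int_a^b\langle\mathscr A u',(\varphi(|u|)u)'\rangle\,dx\ge0$ for all $u\in\mathring C^1$ with $\varphi(|u|)u\in\mathring C^1$. * $A$ is *strict $L^\Phi$-dissipative* if there is $\kappa>0$ such that $\Re\int_a^b\langle\mathscr A u',(\varphi(|u|)u)'\rangle\,dx\ge\kappa\int_a^b|(\sqrt{\varphi(|u|)}\,u)'|^2dx$ for all such $u$. * $\mathscr A$ is *strongly $\Phi$-elliptic* if there is $\kappa>0$ such that for almost every $x\in(a,b)$, all $t>0$ and all $\xi,\omega\in\mathbb C^m$ with $|\omega|=1$, $$\Re\langle\mathscr A(x)\xi,\xi\rangle+\Lambda(t)\,\Re\langle(\mathscr A(x)-\mathscr A^*(x))\omega,\xi\rangle\,\Re\langle\omega,\xi\rangle-\Lambda^2(t)\,\Re\langle\mathscr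 A(x)\omega,\omega\rangle(\Re\langle\omega,\xi\rangle)^2\ge\kappa|\xi|^2 .$$ * $\mathscr A$ is *integrally $\Phi$-elliptic* if there is $\kappa>0$ such that for all $v\in\mathring C^1$ $$\Re\int_a^b\Big(\langle\mathscr A v',v'\rangle+\Lambda(|v|)|v|^{-2}\langle(\mathscr A-\mathscr A^*)v,v'\rangle\Re\langle v,v'\rangle-\Lambda^2(|v|)|v|^{-4}\langle\mathscr A v,v\rangle(\Re\langle v,v'\rangle)^2\Big)dx\ge\kappa\int_a^b|v'|^2dx,$$ where the integrand on the left is taken to be $0$ where $v=0$. * $\mathscr A$ is *weakly $\Phi$-elliptic* if there is $\kappa>0$ such that for almost every $x\in(a,b)$, all $t>0$, $q\in\mathbb R$ and $\lambda,\omega\in\mathbb C^m$ with $|\omega|=1$, $$\Re\langle q^2\mathscr A(x)\lambda,\lambda\rangle-\Lambda^2(t)\Re\langle q^2\mathscr A(x)\omega,\omega\rangle(\Re\langle\lambda,\omega\rangle)^2+\Lambda(t)\Re\big(\langle q^2\mathscr A(x)\omega,\lambda\rangle-\langle q^2\mathscr A(x)\lambda,\omega\rangle\big)\Re\langle\lambda,\omega\rangle\ge\kappa|q|^2|\lambda|^2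 .$$ **Theorem.** Assume $\Lambda_\infty^2<1$. Then the following are equivalent: (a) $A$ is strict $L^\Phi$-dissipative; (b) there is $\kappa>0$ such that $A-\kappa I\,d^2/dx^2$ is $L^\Phi$-dissipative, i.e. the operator $u\mapsto((\mathscr A-\kappa I)u')'$ is; (c) $\mathscr A$ is strongly $\Phi$-elliptic; (d) $\mathscr A$ is integrally $\Phi$-elliptic; (e) $\mathscr A$ is weakly $\Phi$-elliptic. -/

import Mathlib

open Set Filter Topology MeasureTheory

namespace FunctionalDissipativity

noncomputable section

/-- The standing conditions on the weight `φ`; only its values on `(0, ∞)` matter. -/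
structure Admissible (φ : ℝ → ℝ) : Prop where
  pos : ∀ s, 0 < s → 0 < φ s
  contDiffOn : ContDiffOn ℝ 1 φ (Ioi 0)
  deriv_pos : ∀ s, 0 < s → 0 < deriv (fun σ => σ * φ σ) s
  range_eq : (fun s => s * φ s) '' Ioi 0 = Ioi 0
  /-- Behaviour near `0` (for `s < s₀`) and near infinity (for `s ≥ s₁ > s₀`). -/
  growth : ∃ C₁ C₂ r s₀ : ℝ, 0 < C₁ ∧ 0 < C₂ ∧ -1 < r ∧ 0 < s₀ ∧
    (∀ s ∈ Ioo 0 s₀, C₁ * s ^ r ≤ deriv (fun σ => σ * φ σ) s ∧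
      deriv (fun σ => σ * φ σ) s ≤ C₂ * s ^ r) ∧
    (r = 0 → (∃ l : ℝ, 0 < l ∧ Tendsto φ (𝓝[>] 0) (𝓝 l)) ∧
      Tendsto (fun s => s * deriv φ s) (𝓝[>] 0) (𝓝 0)) ∧
    ∃ s₁, s₀ < s₁ ∧ ((∀ s, s₁ ≤ s → 0 ≤ deriv φ s) ∨ (∀ s, s₁ ≤ s → deriv φ s ≤ 0))
  monotone_abs : MonotoneOn (fun s => |s * deriv φ s / φ s|) (Ioi 0)

/-- `Λ(t) = - s φ'(s) / (s φ'(s) + 2 φ(s))`, where `s > 0` is determined by `s √(φ(s)) = t`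
(see `existsUnique_param` and `Lam_apply` below). -/
def Lam (φ : ℝ → ℝ) (t : ℝ) : ℝ :=
  let s := Function.invFunOn (fun σ => σ * √(φ σ)) (Ioi 0) t;
  (-(s * deriv φ s)) / (s * deriv φ s + 2 * φ s)

/-- `Λ_∞² = sup_{t > 0} Λ(t)²` (the set is bounded by `1`, see `Lam_sq_lt_one`). -/
def LamInftySq (φ : ℝ → ℝ) : ℝ := sSup ((fun t => Lam φ t ^ 2) '' Ioi 0)

/-- The open interval `(a, b)`, bounded or unbounded. -/
def interval (a b : EReal) : Set ℝ := {x : ℝ | a < (x : EReal) ∧ (x : EReal) < b}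

/-- `Re ⟨z, w⟩` for the standard Hermitian product of `ℂ^m`, linear in the first slot. -/
def reInner {m : ℕ} (z w : EuclideanSpace ℂ (Fin m)) : ℝ := (inner ℂ w z).re

/-- The vector `M z`. -/
def act {m : ℕ} (M : Matrix (Fin m) (Fin m) ℂ) (z : EuclideanSpace ℂ (Fin m)) :
    EuclideanSpace ℂ (Fin m) := WithLp.toLp 2 (M.mulVec z.ofLp)

/-- Compactly supported `C¹` functions on `Ω` with values in `ℂ^m`, extended by zero to `ℝ`. -/
def TestFun {m : ℕ} (Ω : Set ℝ) (u : ℝ → EuclideanSpace ℂ (Fin m)) : Prop :=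
  ContDiff ℝ 1 u ∧ HasCompactSupport u ∧ tsupport u ⊆ Ω

/-- The function `φ(|u|) u`. -/
def weighted {m : ℕ} (φ : ℝ → ℝ) (u : ℝ → EuclideanSpace ℂ (Fin m)) :
    ℝ → EuclideanSpace ℂ (Fin m) := fun x => φ ‖u x‖ • u x

/-- `L^Φ`-dissipativity of `u ↦ (A u')'` on `Ω`. -/
def Dissipative {m : ℕ} (φ : ℝ → ℝ) (Ω : Set ℝ) (A : ℝ → Matrix (Fin m) (Fin m) ℂ) : Prop :=
  ∀ u : ℝ → EuclideanSpace ℂ (Fin m), TestFun Ω u → TestFun Ω (weighted φ u) →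
    0 ≤ ∫ x in Ω, reInner (act (A x) (deriv u x)) (deriv (weighted φ u) x)

/-- Strict `L^Φ`-dissipativity of `u ↦ (A u')'` on `Ω`. -/
def StrictDissipative {m : ℕ} (φ : ℝ → ℝ) (Ω : Set ℝ)
    (A : ℝ → Matrix (Fin m) (Fin m) ℂ) : Prop :=
  ∃ κ : ℝ, 0 < κ ∧
    ∀ u : ℝ → EuclideanSpace ℂ (Fin m), TestFun Ω u → TestFun Ω (weighted φ u) →
      κ * ∫ x in Ω, ‖deriv (weighted (fun s => √(φ s)) u) x‖ ^ 2 ≤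
        ∫ x in Ω, reInner (act (A x) (deriv u x)) (deriv (weighted φ u) x)

/-- Strong `Φ`-ellipticity (one space dimension). -/
def StrongElliptic {m : ℕ} (φ : ℝ → ℝ) (Ω : Set ℝ)
    (A : ℝ → Matrix (Fin m) (Fin m) ℂ) : Prop :=
  ∃ κ : ℝ, 0 < κ ∧ ∀ᵐ x ∂(volume.restrict Ω), ∀ t : ℝ, 0 < t →
    ∀ ξ ω : EuclideanSpace ℂ (Fin m), ‖ω‖ = 1 →
      κ * ‖ξ‖ ^ 2 ≤ reInner (act (A x) ξ) ξ
        + Lam φ t * reInner (act (A x - (A x).conjTranspose) ω) ξ * reInner ω ξ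
        - Lam φ t ^ 2 * reInner (act (A x) ω) ω * reInner ω ξ ^ 2

open Classical in
/-- The integrand of the form in the integral `Φ`-ellipticity condition, extended by zero to the
set where `v` vanishes. -/
def ellipticIntegrand {m : ℕ} (φ : ℝ → ℝ) (A : ℝ → Matrix (Fin m) (Fin m) ℂ)
    (v : ℝ → EuclideanSpace ℂ (Fin m)) (x : ℝ) : ℝ :=
  if v x = 0 then 0 else
    reInner (act (A x) (deriv v x)) (deriv v x)
      + Lam φ ‖v x‖ * (‖v x‖ ^ 2)⁻¹ *
          reInner (act (A x - (A x).conjTranspose) (v x)) (deriv v x) * reInner (v x) (deriv v x)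
      - Lam φ ‖v x‖ ^ 2 * (‖v x‖ ^ 4)⁻¹ * reInner (act (A x) (v x)) (v x) *
          reInner (v x) (deriv v x) ^ 2

/-- Integral `Φ`-ellipticity (one space dimension). -/
def IntegralElliptic {m : ℕ} (φ : ℝ → ℝ) (Ω : Set ℝ)
    (A : ℝ → Matrix (Fin m) (Fin m) ℂ) : Prop :=
  ∃ κ : ℝ, 0 < κ ∧ ∀ v : ℝ → EuclideanSpace ℂ (Fin m), TestFun Ω v →
    κ * ∫ x in Ω, ‖deriv v x‖ ^ 2 ≤ ∫ x in Ω, ellipticIntegrand φ A v x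

/-- Weak (Legendre-Hadamard) `Φ`-ellipticity (one space dimension). -/
def WeakElliptic {m : ℕ} (φ : ℝ → ℝ) (Ω : Set ℝ)
    (A : ℝ → Matrix (Fin m) (Fin m) ℂ) : Prop :=
  ∃ κ : ℝ, 0 < κ ∧ ∀ᵐ x ∂(volume.restrict Ω), ∀ t : ℝ, 0 < t →
    ∀ (q : ℝ) (ξ ω : EuclideanSpace ℂ (Fin m)), ‖ω‖ = 1 →
      κ * |q| ^ 2 * ‖ξ‖ ^ 2 ≤ reInner (act ((q * q) • A x) ξ) ξ
        - Lam φ t ^ 2 * reInner (act ((q * q) • A x) ω) ω * reInner ξ ω ^ 2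
        + Lam φ t * (reInner (act ((q * q) • A x) ω) ξ - reInner (act ((q * q) • A x) ξ) ω) *
            reInner ξ ω

/-! Facts that make `Lam` and `LamInftySq` meaningful. -/

theorem strictMonoOn_mul {φ : ℝ → ℝ} (h : Admissible φ) :
    StrictMonoOn (fun s => s * φ s) (Ioi 0) := by
  refine strictMonoOn_of_deriv_pos (convex_Ioi 0)
    (continuousOn_id.mul h.contDiffOn.continuousOn) fun s hs => ?_
  rw [interior_Ioi] at hs
  exact h.deriv_pos s hs

theorem mul_sqrt_eq (φ : ℝ → ℝ) {s : ℝ} (hs : 0 < s) :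
    s * √(φ s) = √(s * (s * φ s)) := by
  rw [← mul_assoc, Real.sqrt_mul (by positivity), Real.sqrt_mul_self hs.le]

theorem strictMonoOn_mul_sqrt {φ : ℝ → ℝ} (h : Admissible φ) :
    StrictMonoOn (fun s => s * √(φ s)) (Ioi 0) := by
  intro s hs t ht hst
  have hs' : 0 < s := hs
  have ht' : 0 < t := ht
  have := strictMonoOn_mul h hs ht hst
  have h1 := mul_pos hs' (h.pos s hs')
  simp only at this
  simp only [mul_sqrt_eq φ hs', mul_sqrt_eq φ ht']
  exact Real.sqrt_lt_sqrt (by positivity) (mul_lt_mul'' hst this hs'.le h1.le)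

theorem existsUnique_param {φ : ℝ → ℝ} (h : Admissible φ) {t : ℝ} (ht : 0 < t) :
    ∃! s, 0 < s ∧ s * √(φ s) = t := by
  have hex : ∃ s ∈ Ioi (0 : ℝ), s * (s * φ s) = t ^ 2 := by
    obtain ⟨p, hp, hpt⟩ : t ∈ (fun s => s * φ s) '' Ioi 0 := by rw [h.range_eq]; exact ht
    have hp' : 0 < p := hp
    simp only at hpt
    have hsub : uIcc p t ⊆ Ioi 0 := fun y hy => lt_of_lt_of_le (lt_min hp' ht) hy.1
    have hc : ContinuousOn (fun s => s * (s * φ s)) (uIcc p t) :=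
      (continuousOn_id.mul (continuousOn_id.mul h.contDiffOn.continuousOn)).mono hsub
    have hmem : t ^ 2 ∈ uIcc (p * (p * φ p)) (t * (t * φ t)) := by
      have hm := (strictMonoOn_mul h).monotoneOn
      rcases le_total p t with hle | hle
      · have := hm hp ht hle
        simp only at this
        apply mem_uIcc_of_le <;> nlinarith
      · have := hm ht hp hle
        simp only at this
        apply mem_uIcc_of_ge <;> nlinarith
    obtain ⟨s, hs, hst⟩ := intermediate_value_uIcc hc hmem
    exact ⟨s, hsub hs, hst⟩
  obtain ⟨s, hs, hst⟩ := hex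
  refine ⟨s, ⟨hs, ?_⟩, fun y hy => ?_⟩
  · rw [mul_sqrt_eq φ hs, hst, Real.sqrt_sq ht.le]
  · refine (strictMonoOn_mul_sqrt h).injOn hy.1 hs ?_
    rw [hy.2, mul_sqrt_eq φ hs, hst, Real.sqrt_sq ht.le]

theorem Lam_apply {φ : ℝ → ℝ} (h : Admissible φ) {s : ℝ} (hs : 0 < s) :
    Lam φ (s * √(φ s)) = -(s * deriv φ s) / (s * deriv φ s + 2 * φ s) := by
  have : Function.invFunOn (fun σ => σ * √(φ σ)) (Ioi 0) (s * √(φ s)) = s :=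
    (strictMonoOn_mul_sqrt h).injOn.leftInvOn_invFunOn hs
  simp only [Lam, this]

theorem Lam_sq_lt_one {φ : ℝ → ℝ} (h : Admissible φ) {t : ℝ} (ht : 0 < t) :
    Lam φ t ^ 2 < 1 := by
  obtain ⟨s, ⟨hs, rfl⟩, -⟩ := existsUnique_param h ht
  have hφ := h.pos s hs
  have hd : DifferentiableAt ℝ φ s :=
    (h.contDiffOn.differentiableOn one_ne_zero).differentiableAt (Ioi_mem_nhds hs)
  have h1 := h.deriv_pos s hs
  have h2 : deriv (fun σ => σ * φ σ) s = 1 * φ s + s * deriv φ s :=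
    ((hasDerivAt_id' s).mul hd.hasDerivAt).deriv
  rw [h2] at h1
  have hpos : 0 < s * deriv φ s + 2 * φ s := by linarith
  rw [Lam_apply h hs, div_pow, div_lt_one (by positivity)]
  nlinarith

end

end FunctionalDissipativity

/-! The quadratic form of strong ellipticity factors as Re⟨A(ξ + Λ Re⟨ω,ξ⟩ω), ξ − Λ Re⟨ω,ξ⟩ω⟩
(`ellipticForm_eq`). Put v = √φ(|u|) u and ω = u/|u|. Then Λ is exactly the function for which v' +
Λ(|v|) Re⟨ω,v'⟩ω = √φ u' and v' − Λ(|v|) Re⟨ω,v'⟩ω = (φ(|u|)u)'/√φ. So the dissipativity integrand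
is this form at ξ = v' (`Admissible.reInner_act_radial`). At almost every zero of u all derivatives
involved vanish, so strong ellipticity gives (a) and (d) by integration.

Replacing A by A − κI lowers the form by κ(|ξ|² − Λ² Re⟨ω,ξ⟩²), which lies between κ(1 − Λ_∞²)|ξ|²
and κ|ξ|². Since Λ_∞² < 1, strict inequalities for A can be traded for nonnegativity for A − κI.

It remains to pass from nonnegative integrals to a nonnegative form almost everywhere. Both
integrands are Re⟨B R₁(u)u', R₂(u)u'⟩ with real-linear Rᵢ(u) depending continuously on u ≠ 0. Test
with u equal to a cut-off constant y plus N⁻¹cos(N²x + θ)ψ(x)ξ: its values near the support of ψ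
tend to y while its derivative has size N. Dividing by N² and adding the phases θ = 0 and θ = π/2
leaves ∫ψ² Re⟨B R₁(y)ξ, R₂(y)ξ⟩ ≥ 0, and varying ψ localises in x (`ae_radial_nonneg`). That φ(|u|)u
is C¹ for such u is arranged by a high power of the cutoff and the growth condition at 0
(`Admissible.exists_base`).

Condition (e) is (c) multiplied by q², because in one dimension every gradient has the form qλ. -/

namespace FunctionalDissipativity

/-! ### Algebra of the elliptic form -/

section Algebra

variable {m : ℕ}

theorem reInner_eq_sum (z w : EuclideanSpace ℂ (Fin m)) :
    reInner z w = ∑ i, (z i * (starRingEnd ℂ) (w i)).re := by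
  simp [reInner, PiLp.inner_apply]

theorem reInner_comm (z w : EuclideanSpace ℂ (Fin m)) : reInner z w = reInner w z := by
  rw [reInner, reInner, ← inner_conj_symm, Complex.conj_re]

theorem reInner_self (z : EuclideanSpace ℂ (Fin m)) : reInner z z = ‖z‖ ^ 2 := by
  simpa [reInner] using inner_self_eq_norm_sq (𝕜 := ℂ) z

theorem reInner_add_left (z z' w : EuclideanSpace ℂ (Fin m)) :
    reInner (z + z') w = reInner z w + reInner z' w := by
  simp [reInner]

theorem reInner_sub_left (z z' w : EuclideanSpace ℂ (Fin m)) :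
    reInner (z - z') w = reInner z w - reInner z' w := by
  simp [reInner]

theorem reInner_smul_left (c : ℝ) (z w : EuclideanSpace ℂ (Fin m)) :
    reInner (c • z) w = c * reInner z w := by
  simp [reInner, inner_smul_right_eq_smul]

theorem reInner_add_right (z w w' : EuclideanSpace ℂ (Fin m)) :
    reInner z (w + w') = reInner z w + reInner z w' := by
  simp [reInner]

theorem reInner_sub_right (z w w' : EuclideanSpace ℂ (Fin m)) :
    reInner z (w - w') = reInner z w - reInner z w' := by
  simp [reInner]

theorem reInner_smul_right (c : ℝ) (z w : EuclideanSpace ℂ (Fin m)) :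
    reInner z (c • w) = c * reInner z w := by
  rw [reInner_comm, reInner_smul_left, reInner_comm]

theorem reInner_zero_right (z : EuclideanSpace ℂ (Fin m)) : reInner z 0 = 0 := by
  simp [reInner]

theorem abs_reInner_le (z w : EuclideanSpace ℂ (Fin m)) : |reInner z w| ≤ ‖z‖ * ‖w‖ := by
  refine (Complex.abs_re_le_norm _).trans ((norm_inner_le_norm w z).trans_eq (mul_comm _ _))

@[fun_prop]
theorem continuous_reInner :
    Continuous fun p : EuclideanSpace ℂ (Fin m) × EuclideanSpace ℂ (Fin m) =>
      reInner p.1 p.2 := by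
  unfold reInner; fun_prop

theorem act_add (M : Matrix (Fin m) (Fin m) ℂ) (z w : EuclideanSpace ℂ (Fin m)) :
    act M (z + w) = act M z + act M w := by
  ext i; simp [act, Matrix.mulVec_add]

theorem act_zero (M : Matrix (Fin m) (Fin m) ℂ) : act M 0 = 0 := by
  ext i; simp [act]

theorem act_smul (M : Matrix (Fin m) (Fin m) ℂ) (c : ℝ) (z : EuclideanSpace ℂ (Fin m)) :
    act M (c • z) = c • act M z := by
  ext i; simp [act, Matrix.mulVec_smul]

theorem smul_act (M : Matrix (Fin m) (Fin m) ℂ) (c : ℝ) (z : EuclideanSpace ℂ (Fin m)) :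
    act (c • M) z = c • act M z := by
  ext i; simp [act, Matrix.smul_mulVec]

theorem sub_act (M N : Matrix (Fin m) (Fin m) ℂ) (z : EuclideanSpace ℂ (Fin m)) :
    act (M - N) z = act M z - act N z := by
  ext i; simp [act, Matrix.sub_mulVec]

theorem one_act (z : EuclideanSpace ℂ (Fin m)) : act 1 z = z := by
  ext i; simp [act]

theorem reInner_act_eq_sum (M : Matrix (Fin m) (Fin m) ℂ) (z w : EuclideanSpace ℂ (Fin m)) :
    reInner (act M z) w = ∑ i, ∑ j, (M i j * (z j * (starRingEnd ℂ) (w i))).re := by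
  simp only [reInner_eq_sum, act, Matrix.mulVec, dotProduct, Finset.sum_mul, Complex.re_sum,
    mul_assoc]

theorem reInner_conjTranspose_act (M : Matrix (Fin m) (Fin m) ℂ)
    (z w : EuclideanSpace ℂ (Fin m)) :
    reInner (act M.conjTranspose z) w = reInner (act M w) z := by
  rw [reInner_act_eq_sum, reInner_act_eq_sum, Finset.sum_comm]
  refine Finset.sum_congr rfl fun i _ => Finset.sum_congr rfl fun j _ => ?_
  rw [← Complex.conj_re]
  simp [Matrix.conjTranspose_apply]
  ring

/-- The sum of the moduli of the entries of a matrix. -/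
noncomputable def entrySum (M : Matrix (Fin m) (Fin m) ℂ) : ℝ := ∑ i, ∑ j, ‖M i j‖

theorem entrySum_nonneg (M : Matrix (Fin m) (Fin m) ℂ) : 0 ≤ entrySum M :=
  Finset.sum_nonneg fun _ _ => Finset.sum_nonneg fun _ _ => norm_nonneg _

theorem abs_reInner_act_le (M : Matrix (Fin m) (Fin m) ℂ) (z w : EuclideanSpace ℂ (Fin m)) :
    |reInner (act M z) w| ≤ entrySum M * (‖z‖ * ‖w‖) := by
  rw [reInner_act_eq_sum, entrySum, Finset.sum_mul]
  refine (Finset.abs_sum_le_sum_abs _ _).trans (Finset.sum_le_sum fun i _ => ?_)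
  rw [Finset.sum_mul]
  refine (Finset.abs_sum_le_sum_abs _ _).trans (Finset.sum_le_sum fun j _ => ?_)
  refine (Complex.abs_re_le_norm _).trans ?_
  rw [norm_mul, norm_mul, RCLike.norm_conj]
  gcongr
  · exact PiLp.norm_apply_le z j
  · exact PiLp.norm_apply_le w i

@[fun_prop]
theorem continuous_act (M : Matrix (Fin m) (Fin m) ℂ) : Continuous (act M) := by
  unfold act
  fun_prop

/-- The real-linear map `η ↦ α(|y|) η + β(|y|) Re⟨y, η⟩ y`. -/
noncomputable def radial (α β : ℝ → ℝ) (y η : EuclideanSpace ℂ (Fin m)) : EuclideanSpace ℂ (Fin m) :=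
  α ‖y‖ • η + (β ‖y‖ * reInner y η) • y

theorem radial_smul (α β : ℝ → ℝ) (y η : EuclideanSpace ℂ (Fin m)) (c : ℝ) :
    radial α β y (c • η) = c • radial α β y η := by
  simp only [radial, reInner_smul_right, smul_add, smul_smul]
  congr 2 <;> ring

theorem radial_zero_right (α β : ℝ → ℝ) (y : EuclideanSpace ℂ (Fin m)) :
    radial α β y 0 = 0 := by
  simp [radial, reInner_zero_right]

theorem continuousOn_radial {α β : ℝ → ℝ} (hα : ContinuousOn α (Ioi 0))
    (hβ : ContinuousOn β (Ioi 0)) :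
    ContinuousOn (fun p : EuclideanSpace ℂ (Fin m) × EuclideanSpace ℂ (Fin m) =>
      radial α β p.1 p.2) {p | p.1 ≠ 0} := by
  have hn : MapsTo (fun p : EuclideanSpace ℂ (Fin m) × EuclideanSpace ℂ (Fin m) => ‖p.1‖)
    {p | p.1 ≠ 0} (Ioi 0) := fun p hp => norm_pos_iff.2 hp
  have hc : ContinuousOn (fun p : EuclideanSpace ℂ (Fin m) × EuclideanSpace ℂ (Fin m) => ‖p.1‖)
    {p | p.1 ≠ 0} := by fun_prop
  unfold radial
  exact ((hα.comp hc hn).smul continuousOn_snd).add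
    (((hβ.comp hc hn).mul continuous_reInner.continuousOn).smul continuousOn_fst)

/-- The form `Re⟨M(ξ + Λ Re⟨ω, ξ⟩ ω), ξ - Λ Re⟨ω, ξ⟩ ω⟩` with `Λ = l`. -/
noncomputable def ellipticForm (M : Matrix (Fin m) (Fin m) ℂ) (l : ℝ)
    (ω ξ : EuclideanSpace ℂ (Fin m)) : ℝ :=
  reInner (act M (ξ + (l * reInner ω ξ) • ω)) (ξ - (l * reInner ω ξ) • ω)

/-- Multiply out: the two cross terms are ⟨Mω,ξ⟩ and −⟨Mξ,ω⟩, whose real parts combine into that of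
⟨(M − M*)ω,ξ⟩. -/
theorem ellipticForm_eq (M : Matrix (Fin m) (Fin m) ℂ) (l : ℝ)
    (ω ξ : EuclideanSpace ℂ (Fin m)) :
    ellipticForm M l ω ξ = reInner (act M ξ) ξ
      + l * reInner (act (M - M.conjTranspose) ω) ξ * reInner ω ξ
      - l ^ 2 * reInner (act M ω) ω * reInner ω ξ ^ 2 := by
  simp only [ellipticForm, act_add, act_smul, sub_act, reInner_add_left, reInner_sub_left,
    reInner_sub_right, reInner_smul_left, reInner_smul_right, reInner_conjTranspose_act]
  ring

/-- The form is linear in the matrix, and at the identity it is a difference of squares. -/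
theorem ellipticForm_sub_smul_one (M : Matrix (Fin m) (Fin m) ℂ) (κ l : ℝ)
    (ω ξ : EuclideanSpace ℂ (Fin m)) :
    ellipticForm (M - κ • (1 : Matrix (Fin m) (Fin m) ℂ)) l ω ξ =
      ellipticForm M l ω ξ - κ * (‖ξ‖ ^ 2 - l ^ 2 * ‖ω‖ ^ 2 * reInner ω ξ ^ 2) := by
  simp only [ellipticForm, sub_act, smul_act, one_act, reInner_add_left, reInner_sub_left,
    reInner_sub_right, reInner_smul_left, reInner_smul_right, reInner_comm ξ ω, ← reInner_self]
  ring

theorem sq_reInner_le {ω ξ : EuclideanSpace ℂ (Fin m)} (hω : ‖ω‖ = 1) :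
    reInner ω ξ ^ 2 ≤ ‖ξ‖ ^ 2 := by
  have := abs_reInner_le ω ξ
  rw [hω, one_mul] at this
  exact sq_le_sq' (by linarith [neg_abs_le (reInner ω ξ)]) ((le_abs_self _).trans this)

theorem Lam_sq_le_LamInftySq {φ : ℝ → ℝ} (h : Admissible φ) {t : ℝ} (ht : 0 < t) :
    Lam φ t ^ 2 ≤ LamInftySq φ :=
  le_csSup ⟨1, by rintro _ ⟨t, ht, rfl⟩; exact (Lam_sq_lt_one h ht).le⟩ ⟨t, ht, rfl⟩

theorem norm_sq_sub_le (ω ξ : EuclideanSpace ℂ (Fin m)) (l : ℝ) :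
    ‖ξ‖ ^ 2 - l ^ 2 * ‖ω‖ ^ 2 * reInner ω ξ ^ 2 ≤ ‖ξ‖ ^ 2 := by
  have := mul_nonneg (mul_nonneg (sq_nonneg l) (sq_nonneg ‖ω‖)) (sq_nonneg (reInner ω ξ))
  linarith

/-- Cauchy–Schwarz. With L = Λ_∞² < 1 it makes the form of the identity matrix coercive. -/
theorem le_norm_sq_sub {ω ξ : EuclideanSpace ℂ (Fin m)} (hω : ‖ω‖ = 1) {l L : ℝ}
    (hl : l ^ 2 ≤ L) :
    (1 - L) * ‖ξ‖ ^ 2 ≤ ‖ξ‖ ^ 2 - l ^ 2 * ‖ω‖ ^ 2 * reInner ω ξ ^ 2 := by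
  have h1 := sq_reInner_le (ξ := ξ) hω
  rw [hω]
  nlinarith [mul_le_mul hl h1 (sq_nonneg _) ((sq_nonneg l).trans hl)]

/-- Pointwise nonnegativity of the elliptic form for almost every `x ∈ Ω`. -/
def PointwiseNonneg (φ : ℝ → ℝ) (Ω : Set ℝ) (B : ℝ → Matrix (Fin m) (Fin m) ℂ) : Prop :=
  ∀ᵐ x ∂(volume.restrict Ω), ∀ t : ℝ, 0 < t → ∀ ω ξ : EuclideanSpace ℂ (Fin m), ‖ω‖ = 1 →
    0 ≤ ellipticForm (B x) (Lam φ t) ω ξ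

theorem strongElliptic_iff {φ : ℝ → ℝ} (Ω : Set ℝ) (A : ℝ → Matrix (Fin m) (Fin m) ℂ) :
    StrongElliptic φ Ω A ↔ ∃ κ : ℝ, 0 < κ ∧ ∀ᵐ x ∂(volume.restrict Ω), ∀ t : ℝ, 0 < t →
      ∀ ω ξ : EuclideanSpace ℂ (Fin m), ‖ω‖ = 1 →
        κ * ‖ξ‖ ^ 2 ≤ ellipticForm (A x) (Lam φ t) ω ξ := by
  simp only [ellipticForm_eq]
  constructor
  · rintro ⟨κ, hκ, h⟩
    exact ⟨κ, hκ, h.mono fun x hx t ht ω ξ hω => hx t ht ξ ω hω⟩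
  · rintro ⟨κ, hκ, h⟩
    exact ⟨κ, hκ, h.mono fun x hx t ht ξ ω hω => hx t ht ω ξ hω⟩

theorem PointwiseNonneg.strongElliptic {φ : ℝ → ℝ} (h : Admissible φ) (hΛ : LamInftySq φ < 1)
    {Ω : Set ℝ} {A : ℝ → Matrix (Fin m) (Fin m) ℂ} {κ : ℝ} (hκ : 0 < κ)
    (hB : PointwiseNonneg φ Ω fun x => A x - κ • (1 : Matrix (Fin m) (Fin m) ℂ)) :
    StrongElliptic φ Ω A := by
  rw [strongElliptic_iff]
  refine ⟨κ * (1 - LamInftySq φ), mul_pos hκ (by linarith), hB.mono fun x hx t ht ω ξ hω => ?_⟩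
  have h1 := hx t ht ω ξ hω
  rw [ellipticForm_sub_smul_one] at h1
  have h2 := mul_le_mul_of_nonneg_left
    (le_norm_sq_sub (ξ := ξ) hω (Lam_sq_le_LamInftySq h ht)) hκ.le
  linarith

theorem weakElliptic_iff_strongElliptic (φ : ℝ → ℝ) (Ω : Set ℝ)
    (A : ℝ → Matrix (Fin m) (Fin m) ℂ) : WeakElliptic φ Ω A ↔ StrongElliptic φ Ω A := by
  -- The weak form is q² times the strong one, so q = 1 gives one direction and scaling gives the
  -- other.
  have key : ∀ (M : Matrix (Fin m) (Fin m) ℂ) (l q : ℝ) (ξ ω : EuclideanSpace ℂ (Fin m)),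
      reInner (act ((q * q) • M) ξ) ξ - l ^ 2 * reInner (act ((q * q) • M) ω) ω * reInner ξ ω ^ 2
        + l * (reInner (act ((q * q) • M) ω) ξ - reInner (act ((q * q) • M) ξ) ω) * reInner ξ ω =
      q ^ 2 * (reInner (act M ξ) ξ + l * reInner (act (M - M.conjTranspose) ω) ξ * reInner ω ξ
        - l ^ 2 * reInner (act M ω) ω * reInner ω ξ ^ 2) := by
    intro M l q ξ ω
    simp only [smul_act, sub_act, reInner_smul_left, reInner_sub_left, reInner_conjTranspose_act,
      reInner_comm ξ ω]
    ring
  constructor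
  · rintro ⟨κ, hκ, h⟩
    refine ⟨κ, hκ, h.mono fun x hx t ht ξ ω hω => ?_⟩
    have := hx t ht 1 ξ ω hω
    rw [key] at this
    simpa using this
  · rintro ⟨κ, hκ, h⟩
    refine ⟨κ, hκ, h.mono fun x hx t ht q ξ ω hω => ?_⟩
    rw [key, sq_abs, mul_comm κ, mul_assoc]
    exact mul_le_mul_of_nonneg_left (hx t ht ξ ω hω) (sq_nonneg q)

end Algebra

/-! ### Chain rule, zero sets, and the identity behind Λ -/

section Calculus

variable {m : ℕ}

theorem hasDerivAt_reInner {u v : ℝ → EuclideanSpace ℂ (Fin m)}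
    {u' v' : EuclideanSpace ℂ (Fin m)} {x : ℝ} (hu : HasDerivAt u u' x) (hv : HasDerivAt v v' x) :
    HasDerivAt (fun y => reInner (u y) (v y)) (reInner (u x) v' + reInner u' (v x)) x := by
  have h := (hv.inner ℂ hu)
  have h2 := Complex.reCLM.hasFDerivAt.comp_hasDerivAt x h
  refine h2.congr_deriv ?_
  rw [map_add, add_comm]
  rfl

theorem hasDerivAt_norm {u : ℝ → EuclideanSpace ℂ (Fin m)} {u' : EuclideanSpace ℂ (Fin m)}
    {x : ℝ} (hu : HasDerivAt u u' x) (hx : u x ≠ 0) :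
    HasDerivAt (fun y => ‖u y‖) (reInner (u x) u' / ‖u x‖) x := by
  have h := (hasDerivAt_reInner hu hu).sqrt (by simpa [reInner_self] using hx)
  simp only [reInner_self, Real.sqrt_sq (norm_nonneg _), reInner_comm u'] at h
  refine h.congr_deriv ?_
  field_simp
  ring

/-- Chain rule for `f(|u|) u` away from the zeros of `u`. -/
theorem hasDerivAt_weighted {f : ℝ → ℝ} {f' : ℝ} {u : ℝ → EuclideanSpace ℂ (Fin m)}
    {u' : EuclideanSpace ℂ (Fin m)} {x : ℝ} (hu : HasDerivAt u u' x) (hx : u x ≠ 0)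
    (hf : HasDerivAt f f' ‖u x‖) :
    HasDerivAt (weighted f u)
      (f ‖u x‖ • u' + (f' / ‖u x‖ * reInner (u x) u') • u x) x := by
  have h := (hf.comp x (hasDerivAt_norm hu hx)).smul hu
  refine h.congr_deriv ?_
  rw [mul_div_assoc', div_mul_eq_mul_div]
  rfl

/-- An isolated point of s is isolated from the right, and a subset of the line has only countably
many such points. -/
theorem countable_isolated_zeros (s : Set ℝ) :
    {x ∈ s | ¬ ∃ᶠ y in 𝓝[≠] x, y ∈ s}.Countable := by
  refine (countable_setOfPred_isolated_right_within (s := s)).mono ?_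
  rintro x ⟨hxs, hx⟩
  refine ⟨hxs, ?_⟩
  have hx' : ∀ᶠ y in 𝓝[≠] x, y ∉ s := not_frequently.1 hx
  have h1 : ∀ᶠ y in 𝓝[s ∩ Ioi x] x, y ∉ s :=
    hx'.filter_mono (nhdsWithin_mono x fun y hy => ne_of_gt hy.2)
  refine eventually_false_iff_eq_bot.1 ?_
  filter_upwards [h1, self_mem_nhdsWithin] with y hy hys using hy hys.1

/-- Any function whose zero set contains that of `u` has zero derivative at almost every
zero of `u`. -/
theorem ae_deriv_eq_zero_of_zeros {E F : Type*} [NormedAddCommGroup E] [NormedSpace ℝ E]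
    [Zero F] (u : ℝ → F) :
    ∀ᵐ x, u x = 0 → ∀ w : ℝ → E, (∀ y, u y = 0 → w y = 0) → deriv w x = 0 := by
  -- The exceptional set depends on u alone, so one null set serves u and all its weighted versions.
  have h := (countable_isolated_zeros {x | u x = 0}).ae_notMem volume
  filter_upwards [h] with x hx hux w hw
  have : ∃ᶠ y in 𝓝[≠] x, u y = 0 := by
    by_contra hcon
    exact hx ⟨hux, hcon⟩
  -- No differentiability of w is needed: if w has a derivative at x, accumulating zeros force it to
  -- be 0, and otherwise `deriv` is 0 by convention.
  exact deriv_zero_of_frequently_const (c := 0) (this.mono hw)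

theorem weighted_eq_zero {f : ℝ → ℝ} {u : ℝ → EuclideanSpace ℂ (Fin m)} (x : ℝ)
    (h : u x = 0) : weighted f u x = 0 := by
  simp [weighted, h]

namespace Admissible

variable {φ : ℝ → ℝ} (h : Admissible φ)
include h

theorem hasDerivAt {s : ℝ} (hs : 0 < s) : HasDerivAt φ (deriv φ s) s :=
  ((h.contDiffOn.differentiableOn one_ne_zero).differentiableAt (Ioi_mem_nhds hs)).hasDerivAt

theorem hasDerivAt_mul {s : ℝ} (hs : 0 < s) :
    HasDerivAt (fun σ => σ * φ σ) (φ s + s * deriv φ s) s := by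
  exact ((hasDerivAt_id' s).mul (h.hasDerivAt hs)).congr_deriv (by rw [one_mul])

theorem deriv_mul_eq {s : ℝ} (hs : 0 < s) :
    deriv (fun σ => σ * φ σ) s = φ s + s * deriv φ s :=
  (h.hasDerivAt_mul hs).deriv

theorem denom_pos {s : ℝ} (hs : 0 < s) : 0 < s * deriv φ s + 2 * φ s := by
  have := h.deriv_pos s hs
  rw [h.deriv_mul_eq hs] at this
  linarith [h.pos s hs]

theorem continuousOn_deriv : ContinuousOn (deriv φ) (Ioi 0) :=
  h.contDiffOn.continuousOn_deriv_of_isOpen isOpen_Ioi le_rfl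

theorem hasDerivAt_sqrt {s : ℝ} (hs : 0 < s) :
    HasDerivAt (fun σ => √(φ σ)) (deriv φ s / (2 * √(φ s))) s :=
  (h.hasDerivAt hs).sqrt (h.pos s hs).ne'

theorem image_mul_sqrt : (fun s => s * √(φ s)) '' Ioi 0 = Ioi 0 := by
  ext t
  constructor
  · rintro ⟨s, hs, rfl⟩
    exact mul_pos hs (Real.sqrt_pos.2 (h.pos s hs))
  · intro ht
    obtain ⟨s, hs, -⟩ := existsUnique_param h ht
    exact ⟨s, hs.1, hs.2⟩

theorem continuousOn_Lam : ContinuousOn (Lam φ) (Ioi 0) := by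
  set p : ℝ → ℝ := fun σ => σ * √(φ σ) with hp
  set q : ℝ → ℝ := Function.invFunOn p (Ioi 0) with hq
  have hmem : ∀ t ∈ Ioi (0 : ℝ), q t ∈ Ioi (0 : ℝ) ∧ p (q t) = t := fun t ht => by
    have : ∃ s ∈ Ioi (0 : ℝ), p s = t := by rw [← h.image_mul_sqrt] at ht; exact ht
    exact ⟨Function.invFunOn_mem this, Function.invFunOn_eq this⟩
  have hinv : ∀ s ∈ Ioi (0 : ℝ), q (p s) = s := fun s hs =>
    (strictMonoOn_mul_sqrt h).injOn.leftInvOn_invFunOn hs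
  have hmono : StrictMonoOn q (Ioi 0) := fun a ha b hb hab => by
    refine ((strictMonoOn_mul_sqrt h).lt_iff_lt (hmem a ha).1 (hmem b hb).1).1 ?_
    exact ((hmem a ha).2.trans_lt hab).trans_eq (hmem b hb).2.symm
  have himg : q '' Ioi 0 = Ioi 0 := by
    ext s
    constructor
    · rintro ⟨t, ht, rfl⟩
      exact (hmem t ht).1
    · intro hs
      exact ⟨p s, mul_pos hs (Real.sqrt_pos.2 (h.pos s hs)), hinv s hs⟩
  -- A strictly monotone function whose image is open has no jumps.
  have hqc : ContinuousOn q (Ioi 0) := fun t ht =>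
    (hmono.continuousAt_of_image_mem_nhds (Ioi_mem_nhds ht)
      (by rw [himg]; exact Ioi_mem_nhds (hmem t ht).1)).continuousWithinAt
  have hmaps : MapsTo q (Ioi 0) (Ioi 0) := fun t ht => (hmem t ht).1
  have hφ := h.contDiffOn.continuousOn.comp hqc hmaps
  have hφ' := h.continuousOn_deriv.comp hqc hmaps
  exact ((hqc.mul hφ').neg).div ((hqc.mul hφ').add (continuousOn_const.mul hφ))
    fun t ht => (h.denom_pos (hmaps ht)).ne'

end Admissible

theorem radial_const_smul (α β : ℝ → ℝ) {s : ℝ} (hs : 0 < s) {ω : EuclideanSpace ℂ (Fin m)}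
    (hω : ‖ω‖ = 1) (η : EuclideanSpace ℂ (Fin m)) :
    radial α β (s • ω) η = α s • η + (s ^ 2 * β s * reInner ω η) • ω := by
  have : ‖s • ω‖ = s := by rw [norm_smul, hω, Real.norm_of_nonneg hs.le, mul_one]
  rw [radial, this, reInner_smul_left, smul_smul]
  congr 2
  ring

/-- Read sω as u and η as u'; the two radial maps then give (φ(|u|)u)' and v' for v = √φ(|u|) u. The
factors of `ellipticForm` at v' become √φ u' and (φ(|u|)u)'/√φ, and the two square roots cancel. -/
theorem Admissible.reInner_act_radial {φ : ℝ → ℝ} (h : Admissible φ)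
    (M : Matrix (Fin m) (Fin m) ℂ) {s : ℝ} (hs : 0 < s) {ω : EuclideanSpace ℂ (Fin m)}
    (hω : ‖ω‖ = 1) (η : EuclideanSpace ℂ (Fin m)) :
    reInner (act M η) (radial φ (fun σ => deriv φ σ / σ) (s • ω) η) =
      ellipticForm M (Lam φ (s * √(φ s))) ω
        (radial (fun σ => √(φ σ)) (fun σ => deriv φ σ / (2 * √(φ σ)) / σ) (s • ω) η) := by
  have hg : 0 < √(φ s) := Real.sqrt_pos.2 (h.pos s hs)
  have hg2 : φ s = √(φ s) ^ 2 := (Real.sq_sqrt (h.pos s hs).le).symm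
  have hd := h.denom_pos hs
  -- Here Re⟨ω,v'⟩ = (sφ' + 2φ)/(2√φ) · Re⟨ω,η⟩, and the denominator of Λ cancels the numerator; Λ
  -- then removes exactly the radial correction in v'.
  have hl : Lam φ (s * √(φ s)) * reInner ω
      (radial (fun σ => √(φ σ)) (fun σ => deriv φ σ / (2 * √(φ σ)) / σ) (s • ω) η)
      = -(s * deriv φ s / (2 * √(φ s)) * reInner ω η) := by
    rw [radial_const_smul _ _ hs hω, reInner_add_right, reInner_smul_right, reInner_smul_right,
      reInner_self, hω, Lam_apply h hs]
    rw [div_mul_eq_mul_div, div_eq_iff hd.ne']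
    generalize √(φ s) = g at hg hg2 ⊢
    rw [hg2]
    field_simp
    ring
  rw [ellipticForm, hl, radial_const_smul _ _ hs hω, radial_const_smul _ _ hs hω]
  have e1 : √(φ s) • η + (s ^ 2 * (deriv φ s / (2 * √(φ s)) / s) * reInner ω η) • ω +
      (-(s * deriv φ s / (2 * √(φ s)) * reInner ω η)) • ω = √(φ s) • η := by
    rw [add_assoc, ← add_smul]
    have : s ^ 2 * (deriv φ s / (2 * √(φ s)) / s) * reInner ω η +
      -(s * deriv φ s / (2 * √(φ s)) * reInner ω η) = 0 := by field_simp; ring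
    rw [this, zero_smul, add_zero]
  have e2 : √(φ s) • η + (s ^ 2 * (deriv φ s / (2 * √(φ s)) / s) * reInner ω η) • ω -
      (-(s * deriv φ s / (2 * √(φ s)) * reInner ω η)) • ω =
      (√(φ s))⁻¹ • (φ s • η + (s ^ 2 * (deriv φ s / s) * reInner ω η) • ω) := by
    rw [add_sub_assoc, ← sub_smul, smul_add, smul_smul, smul_smul]
    congr 2
    · rw [eq_inv_mul_iff_mul_eq₀ hg.ne', Real.mul_self_sqrt (h.pos s hs).le]
    · field_simp; ring
  rw [e1, e2, act_smul, reInner_smul_left, reInner_smul_right, ← mul_assoc,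
    mul_inv_cancel₀ hg.ne', one_mul]

theorem Admissible.radial_surjective {φ : ℝ → ℝ} (h : Admissible φ) {s : ℝ} (hs : 0 < s)
    {ω : EuclideanSpace ℂ (Fin m)} (hω : ‖ω‖ = 1) (ξ : EuclideanSpace ℂ (Fin m)) :
    ∃ η, radial (fun σ => √(φ σ)) (fun σ => deriv φ σ / (2 * √(φ σ)) / σ) (s • ω) η = ξ := by
  have hg : 0 < √(φ s) := Real.sqrt_pos.2 (h.pos s hs)
  have hg2 : φ s = √(φ s) ^ 2 := (Real.sq_sqrt (h.pos s hs).le).symm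
  have hd := h.denom_pos hs
  set l := -(s * deriv φ s) / (s * deriv φ s + 2 * φ s) with hl
  -- The relation ξ + Λ Re⟨ω,ξ⟩ω = √φ η, solved for η.
  refine ⟨(√(φ s))⁻¹ • (ξ + (l * reInner ω ξ) • ω), ?_⟩
  rw [radial_const_smul _ _ hs hω]
  simp only [reInner_smul_right, reInner_add_right, reInner_self, hω, smul_smul,
    mul_inv_cancel₀ hg.ne', one_smul]
  rw [add_assoc, ← add_smul]
  have : l * reInner ω ξ + s ^ 2 * (deriv φ s / (2 * √(φ s)) / s) *
      ((√(φ s))⁻¹ * (reInner ω ξ + l * reInner ω ξ * 1 ^ 2)) = 0 := by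
    generalize √(φ s) = g at hg hg2 ⊢
    rw [hg2] at hd hl
    rw [hl]
    have := hd.ne'
    field_simp
    ring
  rw [this, zero_smul, add_zero]

theorem norm_smul_inv_norm_smul {y : EuclideanSpace ℂ (Fin m)} (hy : y ≠ 0) :
    ‖y‖ • (‖y‖⁻¹ • y) = y := by
  rw [smul_smul, mul_inv_cancel₀ (norm_ne_zero_iff.2 hy), one_smul]

theorem norm_inv_norm_smul {y : EuclideanSpace ℂ (Fin m)} (hy : y ≠ 0) : ‖‖y‖⁻¹ • y‖ = 1 := by
  rw [norm_smul, norm_inv, norm_norm, inv_mul_cancel₀ (norm_ne_zero_iff.2 hy)]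

/-- This brings the integral ellipticity integrand to the two-radial-map shape shared with
dissipativity, so that one localisation argument covers both. -/
theorem ellipticForm_eq_radial (M : Matrix (Fin m) (Fin m) ℂ) (φ : ℝ → ℝ) {t : ℝ} (ht : 0 < t)
    {ω : EuclideanSpace ℂ (Fin m)} (hω : ‖ω‖ = 1) (ξ : EuclideanSpace ℂ (Fin m)) :
    ellipticForm M (Lam φ t) ω ξ =
      reInner (act M (radial (fun _ => 1) (fun σ => Lam φ σ / σ ^ 2) (t • ω) ξ))
        (radial (fun _ => 1) (fun σ => -(Lam φ σ / σ ^ 2)) (t • ω) ξ) := by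
  rw [radial_const_smul _ _ ht hω, radial_const_smul _ _ ht hω, ellipticForm, one_smul,
    sub_eq_add_neg, ← neg_smul]
  have : t ^ 2 * (Lam φ t / t ^ 2) = Lam φ t := by field_simp
  rw [this, mul_neg, this, neg_mul]

theorem ellipticIntegrand_eq (φ : ℝ → ℝ) (A : ℝ → Matrix (Fin m) (Fin m) ℂ)
    {v : ℝ → EuclideanSpace ℂ (Fin m)} {x : ℝ} (hx : v x ≠ 0) :
    ellipticIntegrand φ A v x =
      ellipticForm (A x) (Lam φ ‖v x‖) (‖v x‖⁻¹ • v x) (deriv v x) := by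
  rw [ellipticIntegrand, if_neg hx, ellipticForm_eq]
  simp only [act_smul, reInner_smul_left, reInner_smul_right]
  have := norm_ne_zero_iff.2 hx
  field_simp

/-- For almost every `x`, the derivatives of `u`, `φ(|u|)u` and `√φ(|u|)u` are either all zero, or
connected by the chain rule at a point with `u ≠ 0`. -/
theorem Admissible.ae_deriv_weighted {φ : ℝ → ℝ} (h : Admissible φ)
    {u : ℝ → EuclideanSpace ℂ (Fin m)} (hu : Differentiable ℝ u) :
    ∀ᵐ x, (u x = 0 ∧ deriv u x = 0 ∧ deriv (weighted φ u) x = 0 ∧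
        deriv (weighted (fun s => √(φ s)) u) x = 0) ∨
      (u x ≠ 0 ∧
        deriv (weighted φ u) x = radial φ (fun σ => deriv φ σ / σ) (u x) (deriv u x) ∧
        deriv (weighted (fun s => √(φ s)) u) x =
          radial (fun σ => √(φ σ)) (fun σ => deriv φ σ / (2 * √(φ σ)) / σ) (u x) (deriv u x)) := by
  filter_upwards [ae_deriv_eq_zero_of_zeros (E := EuclideanSpace ℂ (Fin m)) u] with x hx
  by_cases hux : u x = 0
  · exact .inl ⟨hux, hx hux _ fun y hy => hy, hx hux _ fun y hy => weighted_eq_zero y hy,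
      hx hux _ fun y hy => weighted_eq_zero y hy⟩
  · have hp := norm_pos_iff.2 hux
    exact .inr ⟨hux, (hasDerivAt_weighted (hu x).hasDerivAt hux (h.hasDerivAt hp)).deriv,
      (hasDerivAt_weighted (hu x).hasDerivAt hux (h.hasDerivAt_sqrt hp)).deriv⟩

/-- The identity of `Admissible.reInner_act_radial` along u, with t = |√φ(|u|) u| and ω = u/|u|. -/
theorem Admissible.ae_reInner_act_deriv {φ : ℝ → ℝ} (h : Admissible φ)
    (B : ℝ → Matrix (Fin m) (Fin m) ℂ) {u : ℝ → EuclideanSpace ℂ (Fin m)}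
    (hu : Differentiable ℝ u) :
    ∀ᵐ x, (reInner (act (B x) (deriv u x)) (deriv (weighted φ u) x) = 0 ∧
        deriv (weighted (fun s => √(φ s)) u) x = 0) ∨
      ∃ t : ℝ, 0 < t ∧ ∃ ω : EuclideanSpace ℂ (Fin m), ‖ω‖ = 1 ∧
        ∀ M, reInner (act M (deriv u x)) (deriv (weighted φ u) x) =
          ellipticForm M (Lam φ t) ω (deriv (weighted (fun s => √(φ s)) u) x) := by
  filter_upwards [h.ae_deriv_weighted hu] with x hx
  rcases hx with ⟨-, -, h2, h3⟩ | ⟨hux, h2, h3⟩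
  · exact .inl ⟨by rw [h2, reInner_zero_right], h3⟩
  · have hp := norm_pos_iff.2 hux
    refine .inr ⟨‖u x‖ * √(φ ‖u x‖), mul_pos hp (Real.sqrt_pos.2 (h.pos _ hp)), ‖u x‖⁻¹ • u x,
      norm_inv_norm_smul hux, fun M => ?_⟩
    have := h.reInner_act_radial M hp (norm_inv_norm_smul hux) (deriv u x)
    rwa [norm_smul_inv_norm_smul hux, ← h2, ← h3] at this

end Calculus

/-! ### Localisation by cutoffs and by rapid oscillation -/

section Integration

variable {m : ℕ}

theorem integrableOn_reInner_act {B : ℝ → Matrix (Fin m) (Fin m) ℂ} {K : Set ℝ}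
    (hB : ∀ i j, IntegrableOn (fun x => B x i j) K)
    {z w : ℝ → EuclideanSpace ℂ (Fin m)} (hz : AEStronglyMeasurable z (volume.restrict K))
    (hw : AEStronglyMeasurable w (volume.restrict K)) {C D : ℝ} (hzC : ∀ x, ‖z x‖ ≤ C)
    (hwD : ∀ x, ‖w x‖ ≤ D) : IntegrableOn (fun x => reInner (act (B x) (z x)) (w x)) K := by
  simp only [reInner_act_eq_sum]
  refine integrable_finsetSum _ fun i _ => integrable_finsetSum _ fun j _ => ?_
  have hzj : AEStronglyMeasurable (fun x => z x j) (volume.restrict K) :=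
    (by fun_prop : Continuous fun y : EuclideanSpace ℂ (Fin m) => y j).comp_aestronglyMeasurable hz
  have hwi : AEStronglyMeasurable (fun x => (starRingEnd ℂ) (w x i)) (volume.restrict K) :=
    (Complex.continuous_conj.comp
      (by fun_prop : Continuous fun y : EuclideanSpace ℂ (Fin m) => y i)).comp_aestronglyMeasurable hw
  have h1 : Integrable (fun x => B x i j * (z x j * (starRingEnd ℂ) (w x i)))
      (volume.restrict K) := by
    refine (hB i j).mul_bdd (c := C * D) (hzj.mul hwi) (ae_of_all _ fun x => ?_)
    rw [norm_mul, RCLike.norm_conj]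
    exact mul_le_mul ((PiLp.norm_apply_le _ _).trans (hzC x))
      ((PiLp.norm_apply_le _ _).trans (hwD x)) (norm_nonneg _) ((norm_nonneg _).trans (hzC x))
  exact h1.re

theorem integrableOn_entrySum {B : ℝ → Matrix (Fin m) (Fin m) ℂ} {K : Set ℝ}
    (hB : ∀ i j, IntegrableOn (fun x => B x i j) K) :
    IntegrableOn (fun x => entrySum (B x)) K :=
  integrable_finsetSum _ fun i _ => integrable_finsetSum _ fun j _ => (hB i j).norm

theorem integrableOn_of_eq_zero {Ω K : Set ℝ} (hΩ : IsOpen Ω) {f : ℝ → ℝ}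
    (hf : IntegrableOn f K) (h0 : ∀ x, x ∉ K → f x = 0) : IntegrableOn f Ω :=
  hf.of_forall_sdiff_eq_zero hΩ.measurableSet fun x hx => h0 x hx.2

/-- The indicator of a compact set is the pointwise limit of squares of bumps supported in shrinking
neighbourhoods; dominated convergence does the rest. -/
theorem setIntegral_isCompact_nonneg_of_integral_sq_mul_nonneg {Ω : Set ℝ} (hΩ : IsOpen Ω)
    {f : ℝ → ℝ} (hf : LocallyIntegrableOn f Ω)
    (h : ∀ ψ : ℝ → ℝ, ContDiff ℝ 1 ψ → HasCompactSupport ψ → tsupport ψ ⊆ Ω →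
      0 ≤ ∫ x in Ω, ψ x ^ 2 * f x) {s : Set ℝ} (hs : IsCompact s) (hsΩ : s ⊆ Ω) :
    0 ≤ ∫ x in s, f x := by
  obtain ⟨δ₁, hδ₁, hc⟩ := hs.exists_isCompact_cthickening
  obtain ⟨δ₂, hδ₂, ht⟩ := hs.exists_cthickening_subset_open hΩ hsΩ
  set K := Metric.cthickening (min δ₁ δ₂) s with hKdef
  have hK : IsCompact K := hc.of_isClosed_subset Metric.isClosed_cthickening
    (Metric.cthickening_mono (min_le_left _ _) s)
  have hKΩ : K ⊆ Ω := (Metric.cthickening_mono (min_le_right _ _) s).trans ht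
  obtain ⟨u, -, u_pos, u_lim⟩ := exists_seq_strictAnti_tendsto' (lt_min hδ₁ hδ₂)
  have hg : ∀ n, ∃ g : ℝ → ℝ, Function.support g = Metric.thickening (u n) s ∧ ContDiff ℝ 1 g ∧
      (∀ x, |g x| ≤ 1) ∧ ∀ x ∈ s, g x = 1 := by
    intro n
    obtain ⟨g, h1, h2, h3, h4⟩ := exists_contMDiff_support_eq_eq_one_iff (n := 1)
      (modelWithCornersSelf ℝ ℝ) Metric.isOpen_thickening hs.isClosed
      (Metric.self_subset_thickening (u_pos n).1 s)
    refine ⟨g, h3, h1.contDiff, fun x => ?_, fun x hx => (h4 x).1 hx⟩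
    have := h2 (mem_range_self x)
    rw [abs_of_nonneg this.1]
    exact this.2
  choose g g_supp g_diff g_le g_one using hg
  have hgK : ∀ n, tsupport (g n) ⊆ K := fun n => by
    rw [tsupport, g_supp]
    exact (Metric.closure_thickening_subset_cthickening _ _).trans
      (Metric.cthickening_mono (u_pos n).2.le s)
  have hpos : ∀ n, 0 ≤ ∫ x in Ω, g n x ^ 2 * f x := fun n =>
    h _ (g_diff n) (hK.of_isClosed_subset (isClosed_tsupport _) (hgK n)) ((hgK n).trans hKΩ)
  have lim : Tendsto (fun n => ∫ x in Ω, g n x ^ 2 * f x) atTop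
      (𝓝 (∫ x in Ω, s.indicator f x)) := by
    refine tendsto_integral_of_dominated_convergence (K.indicator fun x => ‖f x‖) (fun n => ?_)
      ?_ (fun n => ?_) ?_
    · exact ((g_diff n).continuous.pow 2).aestronglyMeasurable.mul hf.aestronglyMeasurable
    · have := (hf.integrableOn_compact_subset hKΩ hK).norm
      exact ((integrable_indicator_iff hK.measurableSet).2 this).integrableOn
    · refine ae_of_all _ fun x => ?_
      refine le_indicator_apply (fun _ => ?_) (fun hxK => ?_)
      · rw [norm_mul, norm_pow]
        exact mul_le_of_le_one_left (norm_nonneg _) (pow_le_one₀ (norm_nonneg _) (g_le n x))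
      · have : g n x = 0 := image_eq_zero_of_notMem_tsupport fun hx => hxK (hgK n hx)
        simp [this]
    · refine ae_of_all _ fun x => ?_
      by_cases hxs : x ∈ s
      · simp [g_one _ x hxs, indicator_of_mem hxs f]
      · rw [indicator_of_notMem hxs f]
        refine tendsto_const_nhds.congr' ?_
        obtain ⟨ε, εpos, hε⟩ : ∃ ε, 0 < ε ∧ x ∉ Metric.thickening ε s := by
          rw [← hs.isClosed.closure_eq, Metric.closure_eq_iInter_thickening s] at hxs
          simpa using hxs
        filter_upwards [(tendsto_order.1 u_lim).2 _ εpos] with n hn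
        have : g n x = 0 := by
          rw [← Function.notMem_support, g_supp]
          exact fun hx => hε (Metric.thickening_mono hn.le s hx)
        simp [this]
  have := ge_of_tendsto' lim hpos
  rwa [setIntegral_indicator hs.measurableSet, inter_eq_self_of_subset_right hsΩ] at this

/-- Were f negative on a set of positive measure, inner regularity would give a compact subset of
positive measure, on which the integral of f would be negative. -/
theorem ae_nonneg_of_integral_sq_mul_nonneg {Ω : Set ℝ} (hΩ : IsOpen Ω)
    {f : ℝ → ℝ} (hf : LocallyIntegrableOn f Ω)
    (h : ∀ ψ : ℝ → ℝ, ContDiff ℝ 1 ψ → HasCompactSupport ψ → tsupport ψ ⊆ Ω →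
      0 ≤ ∫ x in Ω, ψ x ^ 2 * f x) : ∀ᵐ x ∂(volume.restrict Ω), 0 ≤ f x := by
  obtain ⟨f', hf'm, hff'⟩ := hf.aestronglyMeasurable
  have hf'm := hf'm.measurable
  suffices hnull : volume (Ω ∩ {x | f' x < 0}) = 0 by
    have : ∀ᵐ x ∂(volume.restrict Ω), 0 ≤ f' x := by
      rw [ae_restrict_iff' hΩ.measurableSet, ae_iff]
      convert hnull using 2
      ext x
      simp
    filter_upwards [this, hff'] with x hx hx' using hx' ▸ hx
  by_contra hne
  have hmeas : MeasurableSet (Ω ∩ {x | f' x < 0}) :=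
    hΩ.measurableSet.inter (measurableSet_lt hf'm measurable_const)
  obtain ⟨s, hst, hs, hpos⟩ := hmeas.exists_lt_isCompact (pos_iff_ne_zero.2 hne)
  have hsΩ : s ⊆ Ω := fun x hx => (hst hx).1
  have h1 := setIntegral_isCompact_nonneg_of_integral_sq_mul_nonneg hΩ hf h hs hsΩ
  have hint : IntegrableOn (fun x => -f x) s := (hf.integrableOn_compact_subset hsΩ hs).neg
  have hneg : ∀ᵐ x ∂(volume.restrict s), f x < 0 := by
    filter_upwards [ae_restrict_of_ae_restrict_of_subset hsΩ hff',
      ae_restrict_mem hs.measurableSet] with x hx hxs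
    rw [hx]
    exact (hst hxs).2
  have h2 : ∫ x in s, -f x = 0 := by
    refine le_antisymm (by rw [integral_neg]; linarith) (integral_nonneg_of_ae ?_)
    filter_upwards [hneg] with x hx using by simpa using hx.le
  rw [integral_eq_zero_iff_of_nonneg_ae
    (by filter_upwards [hneg] with x hx using by simpa using hx.le) hint] at h2
  have : ∀ᵐ x ∂(volume.restrict s), False := by
    filter_upwards [h2, hneg] with x hx hx'
    simp at hx
    exact hx'.ne hx
  rw [eventually_false_iff_eq_bot, ae_eq_bot, Measure.restrict_eq_zero] at this
  exact hpos.ne' this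

/-- Low-amplitude oscillation `N⁻¹ cos(N² x + θ) ψ(x)` with `N = n + 1`. -/
noncomputable def oscillation (ψ : ℝ → ℝ) (θ : ℝ) (n : ℕ) (x : ℝ) : ℝ :=
  ((n : ℝ) + 1)⁻¹ * Real.cos (((n : ℝ) + 1) ^ 2 * x + θ) * ψ x

theorem contDiff_oscillation {ψ : ℝ → ℝ} (hψ : ContDiff ℝ 1 ψ) (θ : ℝ) (n : ℕ) :
    ContDiff ℝ 1 (oscillation ψ θ n) := by
  unfold oscillation
  fun_prop

theorem deriv_oscillation {ψ : ℝ → ℝ} (hψ : ContDiff ℝ 1 ψ) (θ : ℝ) (n : ℕ) (x : ℝ) :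
    deriv (oscillation ψ θ n) x = ((n : ℝ) + 1) *
      (-(Real.sin (((n : ℝ) + 1) ^ 2 * x + θ) * ψ x) +
        ((((n : ℝ) + 1)⁻¹) ^ 2) * (Real.cos (((n : ℝ) + 1) ^ 2 * x + θ) * deriv ψ x)) := by
  have hn : ((n : ℝ) + 1) ≠ 0 := by positivity
  have h1 : HasDerivAt (fun y => ((n : ℝ) + 1) ^ 2 * y + θ) (((n : ℝ) + 1) ^ 2) x := by
    simpa using ((hasDerivAt_id' x).const_mul (((n : ℝ) + 1) ^ 2)).add_const θ
  have h2 := ((h1.cos.const_mul ((n : ℝ) + 1)⁻¹).mul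
    ((hψ.differentiable one_ne_zero) x).hasDerivAt).deriv
  refine Eq.trans h2 ?_
  field_simp

theorem abs_oscillation_le {ψ : ℝ → ℝ} {M : ℝ} (hM : ∀ x, |ψ x| ≤ M) (θ : ℝ) (n : ℕ) (x : ℝ) :
    |oscillation ψ θ n x| ≤ ((n : ℝ) + 1)⁻¹ * M := by
  have hn : 0 ≤ ((n : ℝ) + 1)⁻¹ := by positivity
  rw [oscillation, abs_mul, abs_mul, abs_of_nonneg hn, mul_assoc]
  refine mul_le_mul_of_nonneg_left ?_ hn
  exact (mul_le_of_le_one_left (abs_nonneg _) (Real.abs_cos_le_one _)).trans (hM x)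

/-- If a quadratic integral functional is bounded below along all small perturbations supported
in `K`, then its principal part, frozen at the unperturbed value, is nonnegative. -/
theorem integral_sq_mul_nonneg_of_perturbation {E : Type*} [NormedAddCommGroup E] [NormedSpace ℝ E]
    {K : Set ℝ} {ψ : ℝ → ℝ} (hψ : ContDiff ℝ 1 ψ)
    (hψc : HasCompactSupport ψ) {f : ℝ → E → ℝ} {y ξ : E} {δ : ℝ}
    (hδ : 0 < δ) {g : ℝ → ℝ} (hg : IntegrableOn g K)
    (hfm : ∀ v : ℝ → E, Continuous v → (∀ x, ‖v x‖ ≤ δ) →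
      AEStronglyMeasurable (fun x => f x (y + v x)) (volume.restrict K))
    (hfg : ∀ x v, ‖v‖ ≤ δ → |f x (y + v)| ≤ g x)
    (hfc : ∀ x, Tendsto (fun v => f x (y + v)) (𝓝 0) (𝓝 (f x y))) (c : ℝ)
    (H : ∀ h : ℝ → ℝ, ContDiff ℝ 1 h → tsupport h ⊆ tsupport ψ → (∀ x, ‖h x • ξ‖ ≤ δ) →
      0 ≤ c + ∫ x in K, deriv h x ^ 2 * f x (y + h x • ξ)) :
    0 ≤ ∫ x in K, ψ x ^ 2 * f x y := by
  obtain ⟨M₁, hM₁⟩ := hψc.exists_bound_of_continuous hψ.continuous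
  obtain ⟨M₂, hM₂⟩ := hψc.deriv.exists_bound_of_continuous (hψ.continuous_deriv le_rfl)
  set M := max M₁ M₂
  have hM : ∀ x, |ψ x| ≤ M := fun x => (hM₁ x).trans (le_max_left _ _)
  have hM' : ∀ x, |deriv ψ x| ≤ M := fun x => (hM₂ x).trans (le_max_right _ _)
  have hM0 : 0 ≤ M := (abs_nonneg _).trans (hM 0)
  -- The derivative of the oscillation divided by N = n + 1; it is bounded uniformly in n.
  set a : ℝ → ℕ → ℝ → ℝ := fun θ n x => -(Real.sin (((n : ℝ) + 1) ^ 2 * x + θ) * ψ x) +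
    ((((n : ℝ) + 1)⁻¹) ^ 2) * (Real.cos (((n : ℝ) + 1) ^ 2 * x + θ) * deriv ψ x) with ha
  have hψ' : Continuous (deriv ψ) := hψ.continuous_deriv le_rfl
  have hac : ∀ θ n, Continuous (a θ n) := fun θ n => by
    simp only [ha]
    fun_prop
  have hab : ∀ θ n x, |a θ n x| ≤ 2 * M := fun θ n x => by
    have h1 : |Real.sin (((n : ℝ) + 1) ^ 2 * x + θ) * ψ x| ≤ M := by
      rw [abs_mul]
      exact (mul_le_of_le_one_left (abs_nonneg _) (Real.abs_sin_le_one _)).trans (hM x)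
    have h2 : |Real.cos (((n : ℝ) + 1) ^ 2 * x + θ) * deriv ψ x| ≤ M := by
      rw [abs_mul]
      exact (mul_le_of_le_one_left (abs_nonneg _) (Real.abs_cos_le_one _)).trans (hM' x)
    have h3 : (((n : ℝ) + 1)⁻¹) ^ 2 ≤ 1 :=
      pow_le_one₀ (by positivity) (inv_le_one_of_one_le₀ (by linarith [n.cast_nonneg (α := ℝ)]))
    calc |a θ n x| ≤ |(-(Real.sin (((n : ℝ) + 1) ^ 2 * x + θ) * ψ x))| +
        |((((n : ℝ) + 1)⁻¹) ^ 2) * (Real.cos (((n : ℝ) + 1) ^ 2 * x + θ) * deriv ψ x)| :=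
          abs_add_le _ _
      _ ≤ M + 1 * M := by
          rw [abs_neg, abs_mul ((((n : ℝ) + 1)⁻¹) ^ 2), abs_of_nonneg (sq_nonneg (((n : ℝ) + 1)⁻¹))]
          exact add_le_add h1 (mul_le_mul h3 h2 (abs_nonneg _) zero_le_one)
      _ = 2 * M := by ring
  have hinv : Tendsto (fun n : ℕ => ((n : ℝ) + 1)⁻¹) atTop (𝓝 0) := by
    simpa using tendsto_one_div_add_atTop_nhds_zero_nat (𝕜 := ℝ)
  have hosc : ∀ θ x, Tendsto (fun n => oscillation ψ θ n x • ξ) atTop (𝓝 0) := fun θ x => by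
    have : Tendsto (fun n => oscillation ψ θ n x) atTop (𝓝 0) :=
      squeeze_zero_norm (fun n => abs_oscillation_le hM θ n x) (by simpa using hinv.mul_const M)
    simpa using this.smul_const ξ
  have hsmall : ∀ᶠ n : ℕ in atTop, ∀ θ x, ‖oscillation ψ θ n x • ξ‖ ≤ δ := by
    have : Tendsto (fun n : ℕ => ((n : ℝ) + 1)⁻¹ * M * ‖ξ‖) atTop (𝓝 0) := by
      simpa using (hinv.mul_const M).mul_const ‖ξ‖
    filter_upwards [this.eventually_le_const hδ] with n hn θ x
    rw [norm_smul]
    exact (mul_le_mul_of_nonneg_right (abs_oscillation_le hM θ n x) (norm_nonneg _)).trans hn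
  obtain ⟨n₀, hn₀⟩ := eventually_atTop.1 hsmall
  set F : ℝ → ℕ → ℝ → ℝ := fun θ n x => a θ n x ^ 2 * f x (y + oscillation ψ θ n x • ξ) with hF
  have hFint : ∀ θ n, n₀ ≤ n → IntegrableOn (F θ n) K ∧ ∀ x, |F θ n x| ≤ (2 * M) ^ 2 * g x := by
    intro θ n hn
    have hb : ∀ x, |F θ n x| ≤ (2 * M) ^ 2 * g x := fun x => by
      rw [hF, abs_mul, abs_pow]
      exact mul_le_mul (pow_le_pow_left₀ (abs_nonneg _) (hab θ n x) 2)
        (hfg x _ (hn₀ n hn θ x)) (abs_nonneg _) (by positivity)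
    refine ⟨(hg.const_mul ((2 * M) ^ 2)).mono' ?_ (ae_of_all _ hb), hb⟩
    exact ((hac θ n).pow 2).aestronglyMeasurable.mul
      (hfm _ ((contDiff_oscillation hψ θ n).continuous.smul continuous_const) (hn₀ n hn θ))
  -- Division by N² normalises h'² and makes the fixed contribution c negligible.
  have hlow : ∀ θ n, n₀ ≤ n → 0 ≤ (((n : ℝ) + 1)⁻¹) ^ 2 * c + ∫ x in K, F θ n x := by
    intro θ n hn
    have hN : ((n : ℝ) + 1) ≠ 0 := by positivity
    have h0 := H (oscillation ψ θ n) (contDiff_oscillation hψ θ n)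
      (closure_mono (fun x hx hx' => hx (by simp [oscillation, hx']))) (hn₀ n hn θ)
    simp only [deriv_oscillation hψ, mul_pow, mul_assoc] at h0
    rw [integral_const_mul] at h0
    have := mul_nonneg (sq_nonneg (((n : ℝ) + 1)⁻¹)) h0
    rw [mul_add, ← mul_assoc _ (((n : ℝ) + 1) ^ 2), ← mul_pow, inv_mul_cancel₀ hN, one_pow,
      one_mul] at this
    exact this
  have hpt : ∀ x, Tendsto (fun n => F 0 n x + F (Real.pi / 2) n x) atTop
      (𝓝 (ψ x ^ 2 * f x y)) := by
    intro x
    have herr : ∀ θ, Tendsto (fun n => a θ n x ^ 2 *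
        (f x (y + oscillation ψ θ n x • ξ) - f x y)) atTop (𝓝 0) := by
      intro θ
      have h1 := ((hfc x).comp (hosc θ x)).sub_const (f x y)
      rw [sub_self] at h1
      refine squeeze_zero_norm (fun n => ?_)
        (by simpa using h1.norm.const_mul ((2 * M) ^ 2))
      rw [norm_mul, norm_pow]
      exact mul_le_mul_of_nonneg_right (pow_le_pow_left₀ (abs_nonneg _) (hab θ n x) 2)
        (norm_nonneg _)
    -- For a single phase sin² converges only weakly; the quarter-period shift supplies cos², giving
    -- a pointwise limit fit for dominated convergence.
    have hsum : ∀ n : ℕ, a 0 n x ^ 2 + a (Real.pi / 2) n x ^ 2 =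
        ψ x ^ 2 + (((n : ℝ) + 1)⁻¹) ^ 4 * deriv ψ x ^ 2 := by
      intro n
      simp only [ha, add_zero, Real.sin_add_pi_div_two, Real.cos_add_pi_div_two]
      have := Real.sin_sq_add_cos_sq (((n : ℝ) + 1) ^ 2 * x)
      linear_combination (ψ x ^ 2 + (((n : ℝ) + 1)⁻¹) ^ 4 * deriv ψ x ^ 2) * this
    have hmain : Tendsto (fun n : ℕ => (ψ x ^ 2 + (((n : ℝ) + 1)⁻¹) ^ 4 * deriv ψ x ^ 2) * f x y)
        atTop (𝓝 (ψ x ^ 2 * f x y)) := by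
      simpa using (((hinv.pow 4).mul_const (deriv ψ x ^ 2)).const_add (ψ x ^ 2)).mul_const (f x y)
    have := ((herr 0).add (herr (Real.pi / 2))).add hmain
    simp only [zero_add] at this
    refine this.congr fun n => ?_
    rw [← hsum]
    simp only [hF]
    ring
  have hlim : Tendsto (fun n => ∫ x in K, (F 0 (n + n₀) x + F (Real.pi / 2) (n + n₀) x)) atTop
      (𝓝 (∫ x in K, ψ x ^ 2 * f x y)) := by
    refine tendsto_integral_of_dominated_convergence (fun x => 2 * ((2 * M) ^ 2 * g x))
      (fun n => ?_) ((hg.const_mul _).const_mul 2) (fun n => ae_of_all _ fun x => ?_)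
      (ae_of_all _ fun x => (hpt x).comp (tendsto_add_atTop_nat n₀))
    · exact ((hFint 0 _ (Nat.le_add_left _ _)).1.add
        (hFint (Real.pi / 2) _ (Nat.le_add_left _ _)).1).aestronglyMeasurable
    · refine (norm_add_le _ _).trans ?_
      rw [two_mul]
      exact add_le_add ((hFint 0 _ (Nat.le_add_left _ _)).2 x)
        ((hFint (Real.pi / 2) _ (Nat.le_add_left _ _)).2 x)
  have hlim' := (((((hinv.comp (tendsto_add_atTop_nat n₀)).pow 2).mul_const c).const_mul 2)).add hlim
  simp only [ne_eq, OfNat.ofNat_ne_zero, not_false_eq_true, zero_pow, zero_mul, mul_zero,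
    zero_add] at hlim'
  refine ge_of_tendsto' hlim' fun n => ?_
  have h1 := hlow 0 (n + n₀) (Nat.le_add_left _ _)
  have h2 := hlow (Real.pi / 2) (n + n₀) (Nat.le_add_left _ _)
  rw [integral_add (hFint 0 _ (Nat.le_add_left _ _)).1
    (hFint (Real.pi / 2) _ (Nat.le_add_left _ _)).1]
  simp only [Function.comp_apply]
  linarith

end Integration

/-! ### Admissible test functions and pointwise nonnegativity -/

section TestFunctions

variable {m : ℕ}

theorem locallyIntegrableOn_entries_sub_smul_one {Ω : Set ℝ} {A : ℝ → Matrix (Fin m) (Fin m) ℂ}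
    (hA : ∀ i j, LocallyIntegrableOn (fun x => A x i j) Ω) (κ : ℝ) (i j : Fin m) :
    LocallyIntegrableOn (fun x => (A x - κ • (1 : Matrix (Fin m) (Fin m) ℂ)) i j) Ω :=
  (hA i j).sub ((locallyIntegrable_const _).locallyIntegrableOn _)

theorem locallyIntegrableOn_reInner_act {Ω : Set ℝ} (hΩ : IsOpen Ω)
    {B : ℝ → Matrix (Fin m) (Fin m) ℂ} (hB : ∀ i j, LocallyIntegrableOn (fun x => B x i j) Ω)
    (z w : EuclideanSpace ℂ (Fin m)) :
    LocallyIntegrableOn (fun x => reInner (act (B x) z) w) Ω := by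
  rw [locallyIntegrableOn_iff hΩ.isLocallyClosed]
  intro k hk hkc
  exact integrableOn_reInner_act (fun i j => (hB i j).integrableOn_compact_subset hk hkc)
    aestronglyMeasurable_const aestronglyMeasurable_const (fun _ => le_rfl) (fun _ => le_rfl)

theorem tendsto_reInner_act {X : Type*} {l : Filter X} {f g : X → EuclideanSpace ℂ (Fin m)}
    {z w : EuclideanSpace ℂ (Fin m)} (M : Matrix (Fin m) (Fin m) ℂ) (hf : Tendsto f l (𝓝 z))
    (hg : Tendsto g l (𝓝 w)) :
    Tendsto (fun x => reInner (act M (f x)) (g x)) l (𝓝 (reInner (act M z) w)) := by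
  have h1 : Tendsto (fun x => act M (f x)) l (𝓝 (act M z)) := ((continuous_act M).tendsto z).comp hf
  exact (Complex.continuous_re.tendsto _).comp (hg.inner h1)

theorem continuousOn_radial_left {α β : ℝ → ℝ} (hα : ContinuousOn α (Ioi 0))
    (hβ : ContinuousOn β (Ioi 0)) (η : EuclideanSpace ℂ (Fin m)) :
    ContinuousOn (fun y => radial α β y η) {0}ᶜ :=
  (continuousOn_radial hα hβ).comp (f := fun y => (y, η)) (by fun_prop) fun _ hy => hy

/-- The integrand of the integral form built from two radial maps. -/
noncomputable def radialIntegrand (B : ℝ → Matrix (Fin m) (Fin m) ℂ) (α₁ β₁ α₂ β₂ : ℝ → ℝ)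
    (u : ℝ → EuclideanSpace ℂ (Fin m)) (x : ℝ) : ℝ :=
  reInner (act (B x) (radial α₁ β₁ (u x) (deriv u x))) (radial α₂ β₂ (u x) (deriv u x))

/-- Off the support of ψ the perturbation changes nothing, so that part of the integral is a
constant. On the support p is locally y, so the derivative is h'ξ and real-linearity of the radial
maps pulls out h'². -/
theorem integral_sq_mul_radial_nonneg {Ω : Set ℝ} (hΩ : IsOpen Ω)
    {B : ℝ → Matrix (Fin m) (Fin m) ℂ} (hB : ∀ i j, LocallyIntegrableOn (fun x => B x i j) Ω)
    {α₁ β₁ α₂ β₂ : ℝ → ℝ} (hα₁ : ContinuousOn α₁ (Ioi 0)) (hβ₁ : ContinuousOn β₁ (Ioi 0))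
    (hα₂ : ContinuousOn α₂ (Ioi 0)) (hβ₂ : ContinuousOn β₂ (Ioi 0))
    {y : EuclideanSpace ℂ (Fin m)} (hy : y ≠ 0) (ξ : EuclideanSpace ℂ (Fin m))
    {ψ : ℝ → ℝ} (hψ : ContDiff ℝ 1 ψ) (hψc : HasCompactSupport ψ) (hψΩ : tsupport ψ ⊆ Ω)
    {p : ℝ → EuclideanSpace ℂ (Fin m)} (hp : ∀ x ∈ tsupport ψ, ∀ᶠ z in 𝓝 x, p z = y)
    (H : ∀ h : ℝ → EuclideanSpace ℂ (Fin m), ContDiff ℝ 1 h → tsupport h ⊆ tsupport ψ →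
      (∀ x, ‖h x‖ < ‖y‖) →
      IntegrableOn (radialIntegrand B α₁ β₁ α₂ β₂ fun x => p x + h x) Ω ∧
      0 ≤ ∫ x in Ω, radialIntegrand B α₁ β₁ α₂ β₂ (fun x => p x + h x) x) :
    0 ≤ ∫ x in Ω, ψ x ^ 2 * reInner (act (B x) (radial α₁ β₁ y ξ)) (radial α₂ β₂ y ξ) := by
  have hy' : 0 < ‖y‖ := norm_pos_iff.2 hy
  -- Perturbations of size at most |y|/2 stay in a compact ball avoiding 0, where the radial maps
  -- are continuous and bounded.
  have hδ : 0 < ‖y‖ / 2 := by positivity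
  have hne : ∀ v : EuclideanSpace ℂ (Fin m), ‖v‖ ≤ ‖y‖ / 2 → y + v ∈ ({0}ᶜ : Set _) := by
    intro v hv h0
    have h0 : y = -v := eq_neg_of_add_eq_zero_left h0
    rw [h0, norm_neg] at hv hy'
    linarith
  have hK : IsCompact (tsupport ψ) := hψc
  have hBK : ∀ i j, IntegrableOn (fun x => B x i j) (tsupport ψ) := fun i j =>
    (hB i j).integrableOn_compact_subset hψΩ hK
  have hbound : ∀ {α β : ℝ → ℝ}, ContinuousOn α (Ioi 0) → ContinuousOn β (Ioi 0) →
      ∃ C, ∀ v : EuclideanSpace ℂ (Fin m), ‖v‖ ≤ ‖y‖ / 2 → ‖radial α β (y + v) ξ‖ ≤ C := by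
    intro α β hα hβ
    obtain ⟨C, hC⟩ := (isCompact_closedBall y (‖y‖ / 2)).exists_bound_of_continuousOn
      ((continuousOn_radial_left hα hβ ξ).mono fun z hz => by
        have := hne (z - y) (by simpa [dist_eq_norm] using hz)
        simpa using this)
    exact ⟨C, fun v hv => hC _ (by simpa [dist_eq_norm] using hv)⟩
  have hlim : ∀ {α β : ℝ → ℝ}, ContinuousOn α (Ioi 0) → ContinuousOn β (Ioi 0) →
      Tendsto (fun v => radial α β (y + v) ξ) (𝓝 0) (𝓝 (radial α β y ξ)) := by
    intro α β hα hβ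
    have h1 : ContinuousAt (fun z => radial α β z ξ) y :=
      (continuousOn_radial_left hα hβ ξ).continuousAt (isOpen_compl_singleton.mem_nhds hy)
    have h2 : Tendsto (fun v : EuclideanSpace ℂ (Fin m) => y + v) (𝓝 0) (𝓝 y) := by
      simpa using (continuous_const_add y).tendsto 0
    exact h1.tendsto.comp h2
  have hcont : ∀ {α β : ℝ → ℝ}, ContinuousOn α (Ioi 0) → ContinuousOn β (Ioi 0) →
      ∀ v : ℝ → EuclideanSpace ℂ (Fin m), Continuous v → (∀ x, ‖v x‖ ≤ ‖y‖ / 2) →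
        Continuous fun x => radial α β (y + v x) ξ := fun hα hβ v hv hvδ =>
    (continuousOn_radial_left hα hβ ξ).comp_continuous (continuous_const.add hv)
      fun x => hne _ (hvδ x)
  obtain ⟨C₁, hC₁⟩ := hbound hα₁ hβ₁
  obtain ⟨C₂, hC₂⟩ := hbound hα₂ hβ₂
  have hC₁0 : 0 ≤ C₁ := (norm_nonneg _).trans (hC₁ 0 (by simpa using hδ.le))
  have key := integral_sq_mul_nonneg_of_perturbation (K := tsupport ψ) (y := y) (ξ := ξ) hψ hψc
    (f := fun x z => reInner (act (B x) (radial α₁ β₁ z ξ)) (radial α₂ β₂ z ξ)) hδ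
    (g := fun x => entrySum (B x) * (C₁ * C₂)) ((integrableOn_entrySum hBK).mul_const _)
    (fun v hv hvδ => (integrableOn_reInner_act hBK (hcont hα₁ hβ₁ v hv hvδ).aestronglyMeasurable
      (hcont hα₂ hβ₂ v hv hvδ).aestronglyMeasurable (fun x => hC₁ _ (hvδ x))
      (fun x => hC₂ _ (hvδ x))).aestronglyMeasurable)
    (fun x v hv => (abs_reInner_act_le _ _ _).trans (mul_le_mul_of_nonneg_left
      (mul_le_mul (hC₁ v hv) (hC₂ v hv) (norm_nonneg _) hC₁0) (entrySum_nonneg _)))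
    (fun x => tendsto_reInner_act (B x) (hlim hα₁ hβ₁) (hlim hα₂ hβ₂))
    (∫ x in Ω \ tsupport ψ, radialIntegrand B α₁ β₁ α₂ β₂ p x) ?_
  · refine key.trans_eq (setIntegral_eq_of_subset_of_forall_sdiff_eq_zero
      hΩ.measurableSet hψΩ fun x hx => ?_).symm
    have : ψ x = 0 := image_eq_zero_of_notMem_tsupport hx.2
    simp [this]
  · intro h hh hhψ hhδ
    have hsub : tsupport (fun x => h x • ξ) ⊆ tsupport ψ :=
      (closure_mono (Function.support_smul_subset_left _ _)).trans hhψ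
    obtain ⟨hint, hpos⟩ := H (fun x => h x • ξ) (hh.smul contDiff_const) hsub
      fun x => (hhδ x).trans_lt (by linarith)
    have hsplit := setIntegral_sdiff (isClosed_tsupport ψ).measurableSet hint hψΩ
    have e1 : ∫ x in Ω \ tsupport ψ, radialIntegrand B α₁ β₁ α₂ β₂ (fun z => p z + h z • ξ) x =
        ∫ x in Ω \ tsupport ψ, radialIntegrand B α₁ β₁ α₂ β₂ p x := by
      refine integral_congr_ae ?_
      filter_upwards [ae_restrict_of_ae_restrict_of_subset (fun x hx => hx.2)
        (ae_restrict_mem (isClosed_tsupport ψ).measurableSet.compl)] with x hx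
      have hev : ∀ᶠ z in 𝓝 x, p z + h z • ξ = p z := by
        filter_upwards [(isClosed_tsupport ψ).isOpen_compl.mem_nhds hx] with z hz
        rw [image_eq_zero_of_notMem_tsupport fun hz' => hz (hhψ hz'), zero_smul, add_zero]
      rw [radialIntegrand, radialIntegrand, hev.self_of_nhds, EventuallyEq.deriv_eq hev]
    have e2 : ∫ x in tsupport ψ, radialIntegrand B α₁ β₁ α₂ β₂ (fun z => p z + h z • ξ) x =
        ∫ x in tsupport ψ, deriv h x ^ 2 * reInner (act (B x) (radial α₁ β₁ (y + h x • ξ) ξ))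
          (radial α₂ β₂ (y + h x • ξ) ξ) := by
      refine setIntegral_congr_fun (isClosed_tsupport ψ).measurableSet fun x hx => ?_
      have hev : ∀ᶠ z in 𝓝 x, p z + h z • ξ = y + h z • ξ := by
        filter_upwards [hp x hx] with z hz
        rw [hz]
      have hd : deriv (fun z => y + h z • ξ) x = deriv h x • ξ :=
        (((hh.differentiable one_ne_zero x).hasDerivAt.smul_const ξ).const_add y).deriv
      simp only [radialIntegrand, hev.self_of_nhds, EventuallyEq.deriv_eq hev, hd, radial_smul, act_smul,
        reInner_smul_left, reInner_smul_right]
      ring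
    rw [e1, e2] at hsplit
    linarith

/-- If an integral form built from two radial maps is nonnegative on small `C¹` perturbations of
cutoffs of constants, then the form is nonnegative pointwise almost everywhere. -/
theorem ae_radial_nonneg {Ω : Set ℝ} (hΩ : IsOpen Ω)
    {B : ℝ → Matrix (Fin m) (Fin m) ℂ} (hB : ∀ i j, LocallyIntegrableOn (fun x => B x i j) Ω)
    {α₁ β₁ α₂ β₂ : ℝ → ℝ} (hα₁ : ContinuousOn α₁ (Ioi 0)) (hβ₁ : ContinuousOn β₁ (Ioi 0))
    (hα₂ : ContinuousOn α₂ (Ioi 0)) (hβ₂ : ContinuousOn β₂ (Ioi 0))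
    (H : ∀ y : EuclideanSpace ℂ (Fin m), y ≠ 0 → ∀ K : Set ℝ, IsCompact K → K ⊆ Ω →
      ∃ p : ℝ → EuclideanSpace ℂ (Fin m), (∀ x ∈ K, ∀ᶠ z in 𝓝 x, p z = y) ∧
        ∀ h : ℝ → EuclideanSpace ℂ (Fin m), ContDiff ℝ 1 h → tsupport h ⊆ K →
          (∀ x, ‖h x‖ < ‖y‖) →
          IntegrableOn (radialIntegrand B α₁ β₁ α₂ β₂ fun x => p x + h x) Ω ∧
          0 ≤ ∫ x in Ω, radialIntegrand B α₁ β₁ α₂ β₂ (fun x => p x + h x) x) :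
    ∀ᵐ x ∂(volume.restrict Ω), ∀ y : EuclideanSpace ℂ (Fin m), y ≠ 0 → ∀ ξ,
      0 ≤ reInner (act (B x) (radial α₁ β₁ y ξ)) (radial α₂ β₂ y ξ) := by
  have h1 : ∀ y : EuclideanSpace ℂ (Fin m), y ≠ 0 → ∀ ξ, ∀ᵐ x ∂(volume.restrict Ω),
      0 ≤ reInner (act (B x) (radial α₁ β₁ y ξ)) (radial α₂ β₂ y ξ) := by
    intro y hy ξ
    refine ae_nonneg_of_integral_sq_mul_nonneg hΩ (locallyIntegrableOn_reInner_act hΩ hB _ _)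
      fun ψ hψ hψc hψΩ => ?_
    obtain ⟨p, hp, hH⟩ := H y hy _ hψc hψΩ
    exact integral_sq_mul_radial_nonneg hΩ hB hα₁ hβ₁ hα₂ hβ₂ hy ξ hψ hψc hψΩ hp hH
  -- The null set so far depends on (y, ξ). A countable dense set of pairs yields a common one, and
  -- continuity extends the inequality to all pairs with y ≠ 0.
  have h2 : ∀ᵐ x ∂(volume.restrict Ω),
      ∀ n : ℕ, TopologicalSpace.denseSeq (EuclideanSpace ℂ (Fin m) × EuclideanSpace ℂ (Fin m)) n ∈
        {q | q.1 ≠ (0 : EuclideanSpace ℂ (Fin m)) → 0 ≤ reInner (act (B x) (radial α₁ β₁ q.1 q.2))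
          (radial α₂ β₂ q.1 q.2)} := by
    rw [ae_all_iff]
    intro n
    by_cases hn : (TopologicalSpace.denseSeq
      (EuclideanSpace ℂ (Fin m) × EuclideanSpace ℂ (Fin m)) n).1 = 0
    · exact ae_of_all _ fun x hx => absurd hn hx
    · filter_upwards [h1 _ hn _] with x hx _ using hx
  filter_upwards [h2] with x hx y hy ξ
  have hc : ContinuousOn (fun q : EuclideanSpace ℂ (Fin m) × EuclideanSpace ℂ (Fin m) =>
      reInner (act (B x) (radial α₁ β₁ q.1 q.2)) (radial α₂ β₂ q.1 q.2)) {q | q.1 ≠ 0} :=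
    fun q hq => tendsto_reInner_act (B x) (continuousOn_radial hα₁ hβ₁ q hq)
      (continuousOn_radial hα₂ hβ₂ q hq)
  have ho : IsOpen {q : EuclideanSpace ℂ (Fin m) × EuclideanSpace ℂ (Fin m) | q.1 ≠ 0} :=
    isOpen_ne_fun continuous_fst continuous_const
  by_contra! hneg
  have hev := (hc.continuousAt (ho.mem_nhds (show (y, ξ) ∈ _ from hy))).eventually_lt_const hneg
  obtain ⟨q, ⟨hq1, hq2⟩, n, rfl⟩ := mem_closure_iff_nhds.1
    ((TopologicalSpace.denseRange_denseSeq _) (y, ξ)) _ (inter_mem hev (ho.mem_nhds hy))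
  exact absurd (hx n hq2) (not_le.2 hq1)

theorem exists_cutoff {Ω K : Set ℝ} (hΩ : IsOpen Ω) (hK : IsCompact K) (hKΩ : K ⊆ Ω) :
    ∃ χ : ℝ → ℝ, ContDiff ℝ 1 χ ∧ HasCompactSupport χ ∧ tsupport χ ⊆ Ω ∧ (∀ x, 0 ≤ χ x) ∧
      ∀ x ∈ K, ∀ᶠ z in 𝓝 x, χ z = 1 := by
  obtain ⟨L, hL, hKL, hLΩ⟩ := exists_compact_between hK hΩ hKΩ
  -- The cutoff equals 1 on all of L, whose interior contains K, so it is 1 on a neighbourhood of K.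
  obtain ⟨N, hN, hLN, hNΩ⟩ := exists_compact_between hL hΩ hLΩ
  obtain ⟨χ, h1, h2, h3, h4⟩ := exists_contMDiff_support_eq_eq_one_iff (n := 1)
    (modelWithCornersSelf ℝ ℝ) isOpen_interior hL.isClosed hLN
  have hsub : tsupport χ ⊆ N := by
    rw [tsupport, h3]
    exact hN.isClosed.closure_interior_subset
  refine ⟨χ, h1.contDiff, hN.of_isClosed_subset (isClosed_tsupport _) hsub, hsub.trans hNΩ,
    fun x => (h2 (mem_range_self x)).1, fun x hx => ?_⟩
  filter_upwards [isOpen_interior.mem_nhds (hKL hx)] with z hz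
  exact (h4 z).1 (interior_subset hz)

theorem TestFun.add_of_tsupport_subset {Ω K : Set ℝ} {p h : ℝ → EuclideanSpace ℂ (Fin m)}
    (hp : TestFun Ω p) (hh : ContDiff ℝ 1 h) (hK : IsCompact K) (hKΩ : K ⊆ Ω)
    (hhK : tsupport h ⊆ K) : TestFun Ω fun x => p x + h x :=
  ⟨hp.1.add hh, hp.2.1.add (hK.of_isClosed_subset (isClosed_tsupport _) hhK),
    (tsupport_add p h).trans (union_subset hp.2.2 (hhK.trans hKΩ))⟩

theorem tsupport_weighted_subset (f : ℝ → ℝ) (u : ℝ → EuclideanSpace ℂ (Fin m)) :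
    tsupport (weighted f u) ⊆ tsupport u :=
  closure_mono fun x hx hx' => hx (weighted_eq_zero x hx')

theorem TestFun.weighted_of_contDiff {Ω : Set ℝ} {f : ℝ → ℝ} {u : ℝ → EuclideanSpace ℂ (Fin m)}
    (hu : TestFun Ω u) (h : ContDiff ℝ 1 (weighted f u)) : TestFun Ω (weighted f u) :=
  ⟨h, hu.2.1.of_isClosed_subset (isClosed_tsupport _) (tsupport_weighted_subset f u),
    (tsupport_weighted_subset f u).trans hu.2.2⟩

theorem contDiffAt_weighted {f : ℝ → ℝ} {u : ℝ → EuclideanSpace ℂ (Fin m)} {x : ℝ}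
    (hf : ContDiffOn ℝ 1 f (Ioi 0)) (hu : ContDiffAt ℝ 1 u x) (hx : u x ≠ 0) :
    ContDiffAt ℝ 1 (weighted f u) x :=
  ((hf.contDiffAt (Ioi_mem_nhds (norm_pos_iff.2 hx))).comp x (hu.norm ℂ hx)).smul hu

namespace Admissible

variable {φ : ℝ → ℝ} (h : Admissible φ)
include h

theorem tendsto_mul_zero : Tendsto (fun s => s * φ s) (𝓝[>] 0) (𝓝 0) := by
  rw [tendsto_order]
  constructor
  · intro c hc
    filter_upwards [self_mem_nhdsWithin] with s hs
    exact hc.trans (mul_pos hs (h.pos s hs))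
  · intro c hc
    obtain ⟨σ, hσ, hσc⟩ : c ∈ (fun s => s * φ s) '' Ioi 0 := by rw [h.range_eq]; exact hc
    filter_upwards [Ioo_mem_nhdsGT hσ] with s hs
    exact (strictMonoOn_mul h hs.1 hσ hs.2).trans_eq hσc

/-- A power of a nonnegative cutoff times a constant vector has a `C¹` weighted version. -/
theorem exists_contDiff_pow {s : ℝ} (hs : 0 < s) :
    ∃ k : ℕ, k ≠ 0 ∧ ContDiff ℝ 1 fun p : ℝ => if p ≤ 0 then 0 else φ (s * p ^ k) * p ^ k := by
  obtain ⟨C₁, C₂, r, s₀, hC₁, hC₂, hr, hs₀, hb, -⟩ := h.growth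
  -- Near 0 the derivative is of order p^(kr + k − 1); k(r + 1) ≥ 2 makes this O(p), so the
  -- extension by zero is C¹.
  obtain ⟨k, hk⟩ := exists_nat_ge (2 / (r + 1))
  have hr' : 0 < r + 1 := by linarith
  rw [div_le_iff₀ hr'] at hk
  have hk0 : k ≠ 0 := by
    rintro rfl
    norm_num at hk
  refine ⟨k, hk0, ?_⟩
  set f : ℝ → ℝ := fun p => if p ≤ 0 then 0 else φ (s * p ^ k) * p ^ k with hf
  set g : ℝ → ℝ := fun p => if p ≤ 0 then 0 else
    deriv (fun σ => σ * φ σ) (s * p ^ k) * (k * p ^ (k - 1)) with hg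
  have hpos : ∀ {p : ℝ}, 0 < p → 0 < s * p ^ k := fun hp => mul_pos hs (pow_pos hp k)
  have evpos : ∀ {p : ℝ}, 0 < p → ∀ᶠ q in 𝓝 p, ¬ q ≤ 0 := fun hp => by
    filter_upwards [Ioi_mem_nhds hp] with q hq using not_le.2 hq
  have evneg : ∀ {p : ℝ}, p < 0 → ∀ᶠ q in 𝓝 p, q ≤ 0 := fun hp => by
    filter_upwards [Iio_mem_nhds hp] with q hq using le_of_lt hq
  have hder : ∀ p : ℝ, p ≠ 0 → HasDerivAt f (g p) p := by
    intro p hp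
    rcases hp.lt_or_gt with hp | hp
    · have e : f =ᶠ[𝓝 p] fun _ => 0 := (evneg hp).mono fun q hq => if_pos hq
      rw [show g p = 0 from if_pos hp.le]
      exact (hasDerivAt_const p (0 : ℝ)).congr_of_eventuallyEq e
    · have e : f =ᶠ[𝓝 p] fun q => s⁻¹ * ((s * q ^ k) * φ (s * q ^ k)) :=
        (evpos hp).mono fun q hq => by
          simp only [hf, if_neg hq]
          field_simp
      rw [show g p = _ from if_neg (not_le.2 hp)]
      have h1 : HasDerivAt (fun q : ℝ => s * q ^ k) (s * (k * p ^ (k - 1))) p :=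
        (hasDerivAt_pow k p).const_mul s
      have h2 := ((h.hasDerivAt_mul (hpos hp)).comp p h1).const_mul s⁻¹
      refine (h2.congr_of_eventuallyEq e).congr_deriv ?_
      rw [h.deriv_mul_eq (hpos hp)]
      field_simp
  have hcf : ContinuousAt f 0 := by
    have f0 : f 0 = 0 := if_pos le_rfl
    rw [continuousAt_iff_continuous_left'_right']
    constructor
    · refine ContinuousWithinAt.congr (f := fun _ => (0 : ℝ)) continuousWithinAt_const
        (fun q hq => if_pos (le_of_lt hq)) f0
    · rw [ContinuousWithinAt, f0]
      have h1 : Tendsto (fun q : ℝ => s * q ^ k) (𝓝[>] 0) (𝓝[>] 0) := by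
        refine tendsto_nhdsWithin_iff.2 ⟨?_, ?_⟩
        · have : Tendsto (fun q : ℝ => s * q ^ k) (𝓝 0) (𝓝 (s * 0 ^ k)) :=
            (by fun_prop : Continuous fun q : ℝ => s * q ^ k).tendsto 0
          rw [zero_pow hk0, mul_zero] at this
          exact this.mono_left nhdsWithin_le_nhds
        · filter_upwards [self_mem_nhdsWithin] with q hq using hpos hq
      have h2 := (h.tendsto_mul_zero.comp h1).const_mul s⁻¹
      rw [mul_zero] at h2
      refine h2.congr' ?_
      filter_upwards [self_mem_nhdsWithin] with q hq
      have hq : ¬ q ≤ 0 := not_le.2 hq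
      simp only [hf, if_neg hq, Function.comp_apply]
      field_simp
  have hcg0 : ContinuousAt g 0 := by
    have g0 : g 0 = 0 := if_pos le_rfl
    rw [ContinuousAt, g0]
    have hbd : ∀ᶠ p in 𝓝 (0 : ℝ), ‖g p‖ ≤ C₂ * s ^ r * k * |p| := by
      have h1 : ∀ᶠ p in 𝓝 (0 : ℝ), s * p ^ k < s₀ := by
        have : Tendsto (fun q : ℝ => s * q ^ k) (𝓝 0) (𝓝 (s * 0 ^ k)) :=
          (by fun_prop : Continuous fun q : ℝ => s * q ^ k).tendsto 0
        rw [zero_pow hk0, mul_zero] at this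
        exact this.eventually_lt_const hs₀
      filter_upwards [h1, Iio_mem_nhds one_pos] with p hp1 hp2
      by_cases hp : p ≤ 0
      · rw [show g p = 0 from if_pos hp, norm_zero]
        positivity
      · rw [show g p = _ from if_neg hp]
        have hp : 0 < p := not_le.1 hp
        have h2 := hb _ ⟨hpos hp, hp1⟩
        have h3 := h.deriv_pos _ (hpos hp)
        rw [Real.norm_of_nonneg (by positivity), abs_of_pos hp]
        have h4 : (s * p ^ k) ^ r * p ^ (k - 1) ≤ s ^ r * p := by
          have h5 : p ^ (k - 1) = p ^ ((k : ℝ) - 1) := by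
            rw [← Real.rpow_natCast, Nat.cast_sub (Nat.one_le_iff_ne_zero.2 hk0), Nat.cast_one]
          rw [Real.mul_rpow hs.le (by positivity), h5, ← Real.rpow_natCast p k,
            ← Real.rpow_mul hp.le, mul_assoc, ← Real.rpow_add hp]
          refine mul_le_mul_of_nonneg_left ?_ (by positivity)
          conv_rhs => rw [← Real.rpow_one p]
          exact Real.rpow_le_rpow_of_exponent_ge hp (le_of_lt hp2) (by linarith)
        calc deriv (fun σ => σ * φ σ) (s * p ^ k) * (k * p ^ (k - 1))
            ≤ C₂ * (s * p ^ k) ^ r * (k * p ^ (k - 1)) :=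
              mul_le_mul_of_nonneg_right h2.2 (by positivity)
          _ = C₂ * k * ((s * p ^ k) ^ r * p ^ (k - 1)) := by ring
          _ ≤ C₂ * k * (s ^ r * p) := mul_le_mul_of_nonneg_left h4 (by positivity)
          _ = C₂ * s ^ r * k * p := by ring
    refine squeeze_zero_norm' hbd ?_
    have : Tendsto (fun p : ℝ => C₂ * s ^ r * k * |p|) (𝓝 0) (𝓝 (C₂ * s ^ r * k * |0|)) :=
      (by fun_prop : Continuous fun p : ℝ => C₂ * s ^ r * k * |p|).tendsto 0
    simpa using this
  have hder' : ∀ p : ℝ, HasDerivAt f (g p) p := fun p => by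
    by_cases hp : p = 0
    · rw [hp]
      exact hasDerivAt_of_hasDerivAt_of_ne hder hcf hcg0
    · exact hder p hp
  have hcg : Continuous g := continuous_iff_continuousAt.2 fun p => by
    rcases lt_trichotomy p 0 with hp | hp | hp
    · exact continuousAt_const.congr (f := fun _ => (0 : ℝ))
        ((evneg hp).mono fun q hq => (if_pos hq).symm)
    · rw [hp]; exact hcg0
    · have hd : ContinuousAt (fun q => φ (s * q ^ k) + s * q ^ k * deriv φ (s * q ^ k)) p := by
        have c1 : ContinuousAt (fun q : ℝ => s * q ^ k) p := by fun_prop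
        have c2 : ContinuousAt φ (s * p ^ k) :=
          h.contDiffOn.continuousOn.continuousAt (Ioi_mem_nhds (hpos hp))
        have c3 : ContinuousAt (deriv φ) (s * p ^ k) :=
          h.continuousOn_deriv.continuousAt (Ioi_mem_nhds (hpos hp))
        exact (ContinuousAt.comp (f := fun q : ℝ => s * q ^ k) c2 c1).add
          (c1.mul (ContinuousAt.comp (f := fun q : ℝ => s * q ^ k) c3 c1))
      refine (hd.mul (by fun_prop : ContinuousAt (fun q : ℝ => k * q ^ (k - 1)) p)).congr
        ((evpos hp).mono fun q hq => ?_)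
      simp only [hg, if_neg hq, Pi.mul_apply]
      rw [h.deriv_mul_eq (hpos (not_le.1 hq))]
  rw [contDiff_one_iff_deriv]
  exact ⟨fun p => (hder' p).differentiableAt, by rwa [funext fun p => (hder' p).deriv]⟩

/-- Cutoffs of constants all of whose small perturbations have `C¹` weighted versions. -/
theorem exists_base {Ω K : Set ℝ} (hΩ : IsOpen Ω) (hK : IsCompact K) (hKΩ : K ⊆ Ω)
    {y : EuclideanSpace ℂ (Fin m)} (hy : y ≠ 0) :
    ∃ p : ℝ → EuclideanSpace ℂ (Fin m), (∀ x ∈ K, ∀ᶠ z in 𝓝 x, p z = y) ∧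
      ∀ q : ℝ → EuclideanSpace ℂ (Fin m), ContDiff ℝ 1 q → tsupport q ⊆ K →
        (∀ x, ‖q x‖ < ‖y‖) → TestFun Ω (fun x => p x + q x) ∧
          TestFun Ω (weighted φ fun x => p x + q x) := by
  obtain ⟨χ, hχ, hχc, hχΩ, hχ0, hχ1⟩ := exists_cutoff hΩ hK hKΩ
  obtain ⟨k, hk, hΨ⟩ := h.exists_contDiff_pow (norm_pos_iff.2 hy)
  have hpK : ∀ x ∈ K, ∀ᶠ z in 𝓝 x, χ z ^ k • y = y := fun x hx => by
    filter_upwards [hχ1 x hx] with z hz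
    rw [hz, one_pow, one_smul]
  have hsub : tsupport (fun x => χ x ^ k • y) ⊆ tsupport χ :=
    closure_mono fun x hx hx' => hx (by simp [hx', hk])
  have hp : TestFun Ω fun x => χ x ^ k • y :=
    ⟨(hχ.pow k).smul contDiff_const, hχc.of_isClosed_subset (isClosed_tsupport _) hsub,
      hsub.trans hχΩ⟩
  have hw : ContDiff ℝ 1 (weighted φ fun x => χ x ^ k • y) := by
    have e : (weighted φ fun x => χ x ^ k • y) = fun x =>
        ((fun p : ℝ => if p ≤ 0 then 0 else φ (‖y‖ * p ^ k) * p ^ k) ∘ χ) x • y := by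
      funext x
      rw [weighted, norm_smul, norm_pow, Real.norm_of_nonneg (hχ0 x), mul_comm, smul_smul]
      simp only [Function.comp_apply]
      split_ifs with hx
      · rw [le_antisymm hx (hχ0 x), zero_pow hk, mul_zero]
      · rfl
    rw [e]
    exact (hΨ.comp hχ).smul contDiff_const
  refine ⟨fun x => χ x ^ k • y, hpK, fun q hq hqK hqy => ?_⟩
  have hu := hp.add_of_tsupport_subset hq hK hKΩ hqK
  refine ⟨hu, hu.weighted_of_contDiff (contDiff_iff_contDiffAt.2 fun x => ?_)⟩
  -- On K the base is y and |q| < |y|, so the sum does not vanish and φ is C¹ at its modulus. Off K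
  -- the perturbation is locally zero, leaving the power of the cutoff.
  by_cases hx : x ∈ K
  · refine contDiffAt_weighted h.contDiffOn hu.1.contDiffAt fun h0 => ?_
    simp only [(hpK x hx).self_of_nhds] at h0
    have := hqy x
    rw [eq_neg_of_add_eq_zero_left h0, norm_neg] at this
    exact lt_irrefl _ this
  · refine hw.contDiffAt.congr_of_eventuallyEq ?_
    filter_upwards [hK.isClosed.isOpen_compl.mem_nhds hx] with z hz
    have : q z = 0 := image_eq_zero_of_notMem_tsupport fun hz' => hz (hqK hz')
    simp only [weighted, this, add_zero]

end Admissible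

end TestFunctions

/-! ### The implications between the conditions -/

section Equivalence

variable {m : ℕ} {φ : ℝ → ℝ} {Ω : Set ℝ} {A B : ℝ → Matrix (Fin m) (Fin m) ℂ}

theorem isOpen_interval (a b : EReal) : IsOpen (interval a b) :=
  (isOpen_lt continuous_const continuous_coe_real_ereal).inter
    (isOpen_lt continuous_coe_real_ereal continuous_const)

theorem TestFun.exists_bound_deriv {u : ℝ → EuclideanSpace ℂ (Fin m)} (hu : TestFun Ω u) :
    ∃ C, ∀ x, ‖deriv u x‖ ≤ C :=
  hu.2.1.deriv.exists_bound_of_continuous (hu.1.continuous_deriv le_rfl)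

theorem deriv_eq_zero_of_notMem_tsupport {u : ℝ → EuclideanSpace ℂ (Fin m)} {x : ℝ}
    (hx : x ∉ tsupport u) : deriv u x = 0 :=
  image_eq_zero_of_notMem_tsupport fun hx' => hx (tsupport_deriv_subset hx')

theorem TestFun.integrableOn_dissipative (hΩ : IsOpen Ω)
    (hB : ∀ i j, LocallyIntegrableOn (fun x => B x i j) Ω)
    {u w : ℝ → EuclideanSpace ℂ (Fin m)} (hu : TestFun Ω u) (hw : TestFun Ω w) :
    IntegrableOn (fun x => reInner (act (B x) (deriv u x)) (deriv w x)) Ω := by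
  obtain ⟨C, hC⟩ := hu.exists_bound_deriv
  obtain ⟨D, hD⟩ := hw.exists_bound_deriv
  refine integrableOn_of_eq_zero hΩ (integrableOn_reInner_act (K := tsupport u)
    (fun i j => (hB i j).integrableOn_compact_subset hu.2.2 hu.2.1)
    (hu.1.continuous_deriv le_rfl).aestronglyMeasurable
    (hw.1.continuous_deriv le_rfl).aestronglyMeasurable hC hD) fun x hx => ?_
  rw [deriv_eq_zero_of_notMem_tsupport hx, act_zero, reInner_comm, reInner_zero_right]

theorem ellipticForm_one (l : ℝ) (ω ξ : EuclideanSpace ℂ (Fin m)) :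
    ellipticForm 1 l ω ξ = ‖ξ‖ ^ 2 - l ^ 2 * ‖ω‖ ^ 2 * reInner ω ξ ^ 2 := by
  simp only [ellipticForm, one_act, reInner_add_left, reInner_sub_right, reInner_smul_left,
    reInner_smul_right, reInner_comm ξ ω, ← reInner_self]
  ring

theorem StrongElliptic.strictDissipative (h : Admissible φ) (hΩ : IsOpen Ω)
    (hA : ∀ i j, LocallyIntegrableOn (fun x => A x i j) Ω) (hs : StrongElliptic φ Ω A) :
    StrictDissipative φ Ω A := by
  obtain ⟨κ, hκ, hs⟩ := (strongElliptic_iff Ω A).1 hs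
  refine ⟨κ, hκ, fun u hu hw => ?_⟩
  rw [← integral_const_mul]
  -- Only the larger function must be shown integrable; (√φ(|u|) u)' need not be continuous.
  refine integral_mono_of_nonneg (ae_of_all _ fun x => by positivity)
    (hu.integrableOn_dissipative hΩ hA hw) ?_
  filter_upwards [hs, ae_restrict_of_ae
    (h.ae_reInner_act_deriv A (hu.1.differentiable one_ne_zero))] with x hx hux
  rcases hux with ⟨h1, h2⟩ | ⟨t, ht, ω, hω, h1⟩
  · rw [h1, h2, norm_zero]
    simp
  · rw [h1]
    exact hx t ht ω _ hω

/-- The same κ works: the form of the identity is at most |v'|², where v = √φ(|u|) u. -/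
theorem StrictDissipative.dissipative_sub (h : Admissible φ) (hΛ : LamInftySq φ < 1)
    (hΩ : IsOpen Ω) (hA : ∀ i j, LocallyIntegrableOn (fun x => A x i j) Ω)
    (hs : StrictDissipative φ Ω A) :
    ∃ κ : ℝ, 0 < κ ∧
      Dissipative φ Ω fun x => A x - κ • (1 : Matrix (Fin m) (Fin m) ℂ) := by
  obtain ⟨κ, hκ, hs⟩ := hs
  refine ⟨κ, hκ, fun u hu hw => ?_⟩
  have hone : IntegrableOn (fun x => reInner (act 1 (deriv u x)) (deriv (weighted φ u) x)) Ω :=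
    hu.integrableOn_dissipative (B := fun _ => 1) hΩ
      (fun i j => (locallyIntegrable_const _).locallyIntegrableOn _) hw
  have hbd : ∀ᵐ x ∂(volume.restrict Ω),
      (1 - LamInftySq φ) * ‖deriv (weighted (fun s => √(φ s)) u) x‖ ^ 2 ≤
          reInner (act 1 (deriv u x)) (deriv (weighted φ u) x) ∧
        reInner (act 1 (deriv u x)) (deriv (weighted φ u) x) ≤
          ‖deriv (weighted (fun s => √(φ s)) u) x‖ ^ 2 := by
    filter_upwards [ae_restrict_of_ae
      (h.ae_reInner_act_deriv (fun _ => 1) (hu.1.differentiable one_ne_zero))] with x hux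
    rcases hux with ⟨h1, h2⟩ | ⟨t, ht, ω, hω, h1⟩
    · rw [h1, h2, norm_zero]
      simp
    · rw [h1, ellipticForm_one]
      exact ⟨le_norm_sq_sub hω (Lam_sq_le_LamInftySq h ht), norm_sq_sub_le _ _ _⟩
  have hΛ' : 0 < 1 - LamInftySq φ := by linarith
  -- Since v need not be C¹, integrability of |v'|² comes from the form of the identity, which
  -- bounds (1 − Λ_∞²)|v'|² from above.
  have hsq : IntegrableOn (fun x => ‖deriv (weighted (fun s => √(φ s)) u) x‖ ^ 2) Ω := by
    refine (hone.const_mul (1 - LamInftySq φ)⁻¹).mono'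
      ((stronglyMeasurable_deriv _).norm.pow 2).aestronglyMeasurable ?_
    filter_upwards [hbd] with x hx
    rw [Real.norm_of_nonneg (by positivity), ← div_eq_inv_mul, le_div_iff₀' hΛ']
    exact hx.1
  have hle : ∫ x in Ω, reInner (act 1 (deriv u x)) (deriv (weighted φ u) x) ≤
      ∫ x in Ω, ‖deriv (weighted (fun s => √(φ s)) u) x‖ ^ 2 :=
    integral_mono_ae hone hsq (hbd.mono fun x hx => hx.2)
  have e : ∀ x, reInner (act (A x - κ • (1 : Matrix (Fin m) (Fin m) ℂ)) (deriv u x))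
      (deriv (weighted φ u) x) = reInner (act (A x) (deriv u x)) (deriv (weighted φ u) x) -
        κ * reInner (act 1 (deriv u x)) (deriv (weighted φ u) x) := fun x => by
    rw [sub_act, smul_act, reInner_sub_left, reInner_smul_left]
  simp only [e]
  rw [integral_sub (hu.integrableOn_dissipative hΩ hA hw) (hone.const_mul κ), integral_const_mul]
  have := hs u hu hw
  have := mul_le_mul_of_nonneg_left hle hκ.le
  linarith

/-- Localisation with R₁ the identity and R₂ the differential of φ(|u|)u gives an inequality in η =
u'. Surjectivity of η ↦ ξ = v' carries it to every ξ. -/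
theorem Dissipative.pointwiseNonneg (h : Admissible φ) (hΩ : IsOpen Ω)
    (hB : ∀ i j, LocallyIntegrableOn (fun x => B x i j) Ω) (hd : Dissipative φ Ω B) :
    PointwiseNonneg φ Ω B := by
  have key := ae_radial_nonneg hΩ hB (α₁ := fun _ => 1) (β₁ := fun _ => 0) (α₂ := φ)
    (β₂ := fun σ => deriv φ σ / σ) continuousOn_const continuousOn_const h.contDiffOn.continuousOn
    (h.continuousOn_deriv.div continuousOn_id fun σ hσ => ne_of_gt hσ) ?_
  · filter_upwards [key] with x hx t ht ω ξ hω
    obtain ⟨s, ⟨hs, rfl⟩, -⟩ := existsUnique_param h ht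
    obtain ⟨η, rfl⟩ := h.radial_surjective hs hω ξ
    rw [← h.reInner_act_radial (B x) hs hω η]
    have hne : s • ω ≠ 0 := smul_ne_zero hs.ne' (norm_ne_zero_iff.1 (by rw [hω]; exact one_ne_zero))
    simpa [radial] using hx (s • ω) hne η
  · intro y hy K hK hKΩ
    obtain ⟨p, hpK, hp⟩ := h.exists_base hΩ hK hKΩ hy
    refine ⟨p, hpK, fun q hq hqK hqy => ?_⟩
    obtain ⟨hu, hw⟩ := hp q hq hqK hqy
    have e : (fun x => reInner (act (B x) (deriv (fun z => p z + q z) x))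
        (deriv (weighted φ fun z => p z + q z) x)) =ᵐ[volume.restrict Ω]
        radialIntegrand B (fun _ => 1) (fun _ => 0) φ (fun σ => deriv φ σ / σ)
          fun z => p z + q z := by
      filter_upwards [ae_restrict_of_ae
        (h.ae_deriv_weighted (hu.1.differentiable one_ne_zero))] with x hx
      rcases hx with ⟨-, h1, h2, -⟩ | ⟨-, h2, -⟩
      · rw [radialIntegrand, h1, h2, radial_zero_right, radial_zero_right]
      · rw [radialIntegrand, h2]
        simp [radial]
    exact ⟨(hu.integrableOn_dissipative hΩ hB hw).congr e, (hd _ hu hw).trans_eq (integral_congr_ae e)⟩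

theorem Admissible.continuousOn_Lam_div (h : Admissible φ) :
    ContinuousOn (fun σ => Lam φ σ / σ ^ 2) (Ioi 0) :=
  h.continuousOn_Lam.div (by fun_prop) fun _ hσ => pow_ne_zero 2 (ne_of_gt hσ)

theorem norm_radial_one_le {β : ℝ → ℝ} (hβ : ∀ t, 0 < t → |t ^ 2 * β t| ≤ 1)
    (y η : EuclideanSpace ℂ (Fin m)) : ‖radial (fun _ => 1) β y η‖ ≤ 2 * ‖η‖ := by
  by_cases hy : y = 0
  · simp only [radial, hy, smul_zero, add_zero, one_smul]
    linarith [norm_nonneg η]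
  · have hp := norm_pos_iff.2 hy
    rw [radial, one_smul, two_mul]
    refine (norm_add_le _ _).trans (add_le_add_right ?_ _)
    rw [norm_smul, norm_mul, Real.norm_eq_abs, Real.norm_eq_abs]
    calc |β ‖y‖| * |reInner y η| * ‖y‖ ≤ |β ‖y‖| * (‖y‖ * ‖η‖) * ‖y‖ := by
          gcongr
          exact abs_reInner_le y η
      _ = |‖y‖ ^ 2 * β ‖y‖| * ‖η‖ := by
          rw [abs_mul, abs_of_nonneg (sq_nonneg ‖y‖)]
          ring
      _ ≤ 1 * ‖η‖ := mul_le_mul_of_nonneg_right (hβ _ hp) (norm_nonneg _)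
      _ = ‖η‖ := one_mul _

theorem measurable_radial_comp {α β : ℝ → ℝ} (hα : ContinuousOn α (Ioi 0))
    (hβ : ContinuousOn β (Ioi 0)) {v w : ℝ → EuclideanSpace ℂ (Fin m)} (hv : Measurable v)
    (hw : Measurable w) : Measurable fun x => radial α β (v x) (w x) := by
  have hn : ∀ {γ : ℝ → ℝ}, ContinuousOn γ (Ioi 0) → Measurable fun x => γ ‖v x‖ := by
    intro γ hγ
    have : Measurable fun y : EuclideanSpace ℂ (Fin m) => γ ‖y‖ :=
      measurable_of_continuousOn_compl_singleton 0
        (hγ.comp continuous_norm.continuousOn fun y hy => norm_pos_iff.2 hy)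
    exact this.comp hv
  have hr : Measurable fun x => reInner (v x) (w x) := by
    unfold reInner
    exact Complex.measurable_re.comp (hw.inner hv)
  exact ((hn hα).smul hw).add (((hn hβ).mul hr).smul hv)

/-- Extending the integrand by zero is harmless because v' = 0 at almost every zero of v. -/
theorem ae_ellipticIntegrand_eq (φ : ℝ → ℝ) (B : ℝ → Matrix (Fin m) (Fin m) ℂ)
    (v : ℝ → EuclideanSpace ℂ (Fin m)) :
    ellipticIntegrand φ B v =ᵐ[volume] radialIntegrand B (fun _ => 1) (fun σ => Lam φ σ / σ ^ 2)
      (fun _ => 1) (fun σ => -(Lam φ σ / σ ^ 2)) v := by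
  filter_upwards [ae_deriv_eq_zero_of_zeros (E := EuclideanSpace ℂ (Fin m)) v] with x hx
  by_cases hvx : v x = 0
  · rw [radialIntegrand, hx hvx v fun _ hy => hy, radial_zero_right, radial_zero_right,
      reInner_zero_right, ellipticIntegrand, if_pos hvx]
  · rw [ellipticIntegrand_eq φ B hvx, ellipticForm_eq_radial _ _ (norm_pos_iff.2 hvx)
      (norm_inv_norm_smul hvx), norm_smul_inv_norm_smul hvx, radialIntegrand]

theorem TestFun.integrableOn_ellipticIntegrand (h : Admissible φ) (hΩ : IsOpen Ω)
    (hB : ∀ i j, LocallyIntegrableOn (fun x => B x i j) Ω)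
    {v : ℝ → EuclideanSpace ℂ (Fin m)} (hv : TestFun Ω v) :
    IntegrableOn (ellipticIntegrand φ B v) Ω := by
  have e : ellipticIntegrand φ B v =ᵐ[volume.restrict Ω] _ :=
    ae_restrict_of_ae (ae_ellipticIntegrand_eq φ B v)
  refine Integrable.congr ?_ e.symm
  obtain ⟨C, hC⟩ := hv.exists_bound_deriv
  have hvm : Measurable v := hv.1.continuous.measurable
  have hdm : Measurable (deriv v) := (hv.1.continuous_deriv le_rfl).measurable
  have hb : ∀ t, 0 < t → |t ^ 2 * (Lam φ t / t ^ 2)| ≤ 1 := fun t ht => by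
    rw [mul_div_cancel₀ _ (by positivity), ← sq_le_one_iff_abs_le_one]
    exact (Lam_sq_lt_one h ht).le
  have hc : ∀ x, 2 * ‖deriv v x‖ ≤ 2 * C := fun x => by linarith [hC x]
  refine integrableOn_of_eq_zero hΩ (integrableOn_reInner_act (K := tsupport v)
    (fun i j => (hB i j).integrableOn_compact_subset hv.2.2 hv.2.1)
    (measurable_radial_comp continuousOn_const h.continuousOn_Lam_div hvm hdm).aestronglyMeasurable
    (measurable_radial_comp continuousOn_const h.continuousOn_Lam_div.neg hvm
      hdm).aestronglyMeasurable
    (fun x => (norm_radial_one_le hb _ _).trans (hc x))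
    (fun x => (norm_radial_one_le (fun t ht => ?_) _ _).trans (hc x))) fun x hx => ?_
  · rw [mul_neg, abs_neg]
    exact hb t ht
  · rw [radialIntegrand, deriv_eq_zero_of_notMem_tsupport hx, radial_zero_right, radial_zero_right,
      reInner_zero_right]

theorem StrongElliptic.integralElliptic (h : Admissible φ) (hΩ : IsOpen Ω)
    (hA : ∀ i j, LocallyIntegrableOn (fun x => A x i j) Ω) (hs : StrongElliptic φ Ω A) :
    IntegralElliptic φ Ω A := by
  obtain ⟨κ, hκ, hs⟩ := (strongElliptic_iff Ω A).1 hs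
  refine ⟨κ, hκ, fun v hv => ?_⟩
  rw [← integral_const_mul]
  refine integral_mono_of_nonneg (ae_of_all _ fun x => by positivity)
    (hv.integrableOn_ellipticIntegrand h hΩ hA) ?_
  filter_upwards [hs, ae_restrict_of_ae
    (ae_deriv_eq_zero_of_zeros (E := EuclideanSpace ℂ (Fin m)) v)] with x hx hvx
  by_cases h0 : v x = 0
  · rw [hvx h0 v fun _ hy => hy, ellipticIntegrand, if_pos h0, norm_zero]
    simp
  · rw [ellipticIntegrand_eq φ A h0]
    exact hx _ (norm_pos_iff.2 h0) _ _ (norm_inv_norm_smul h0)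

theorem IntegralElliptic.exists_integral_nonneg (h : Admissible φ) (hΩ : IsOpen Ω)
    (hA : ∀ i j, LocallyIntegrableOn (fun x => A x i j) Ω) (hi : IntegralElliptic φ Ω A) :
    ∃ κ : ℝ, 0 < κ ∧ ∀ v : ℝ → EuclideanSpace ℂ (Fin m), TestFun Ω v →
      0 ≤ ∫ x in Ω, ellipticIntegrand φ
        (fun x => A x - κ • (1 : Matrix (Fin m) (Fin m) ℂ)) v x := by
  obtain ⟨κ, hκ, hi⟩ := hi
  refine ⟨κ, hκ, fun v hv => ?_⟩
  have hsq : IntegrableOn (fun x => ‖deriv v x‖ ^ 2) Ω := by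
    have hc : HasCompactSupport fun x => ‖deriv v x‖ ^ 2 :=
      hv.2.1.deriv.comp_left (g := fun z => ‖z‖ ^ 2) (by simp)
    exact (((hv.1.continuous_deriv le_rfl).norm.pow 2).integrable_of_hasCompactSupport
      hc).integrableOn
  have hI := hv.integrableOn_ellipticIntegrand h hΩ hA
  have hle : ∫ x in Ω, (ellipticIntegrand φ A v x - κ * ‖deriv v x‖ ^ 2) ≤
      ∫ x in Ω, ellipticIntegrand φ (fun x => A x - κ • (1 : Matrix (Fin m) (Fin m) ℂ)) v x := by
    refine integral_mono (hI.sub (hsq.const_mul κ)) (hv.integrableOn_ellipticIntegrand h hΩ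
      (locallyIntegrableOn_entries_sub_smul_one hA κ)) fun x => ?_
    -- At a zero of v the left side is −κ|v'|² and the right side is 0, so the comparison holds at
    -- every point.
    by_cases h0 : v x = 0
    · simp only [ellipticIntegrand, if_pos h0, zero_sub, neg_nonpos]
      positivity
    · simp only [ellipticIntegrand_eq φ _ h0, ellipticForm_sub_smul_one]
      exact sub_le_sub_left (mul_le_mul_of_nonneg_left (norm_sq_sub_le _ _ _) hκ.le) _
  rw [integral_sub hI (hsq.const_mul κ), integral_const_mul] at hle
  linarith [hi v hv]

theorem pointwiseNonneg_of_integral_nonneg (h : Admissible φ) (hΩ : IsOpen Ω)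
    (hB : ∀ i j, LocallyIntegrableOn (fun x => B x i j) Ω)
    (hi : ∀ v : ℝ → EuclideanSpace ℂ (Fin m), TestFun Ω v →
      0 ≤ ∫ x in Ω, ellipticIntegrand φ B v x) :
    PointwiseNonneg φ Ω B := by
  have key := ae_radial_nonneg hΩ hB (α₁ := fun _ => 1) (β₁ := fun σ => Lam φ σ / σ ^ 2)
    (α₂ := fun _ => 1) (β₂ := fun σ => -(Lam φ σ / σ ^ 2)) continuousOn_const
    h.continuousOn_Lam_div continuousOn_const h.continuousOn_Lam_div.neg ?_
  · filter_upwards [key] with x hx t ht ω ξ hω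
    rw [ellipticForm_eq_radial _ _ ht hω]
    exact hx _ (smul_ne_zero ht.ne' (norm_ne_zero_iff.1 (by rw [hω]; exact one_ne_zero))) _
  · intro y hy K hK hKΩ
    obtain ⟨p, hpK, hp⟩ := h.exists_base hΩ hK hKΩ hy
    refine ⟨p, hpK, fun q hq hqK hqy => ?_⟩
    have hv := (hp q hq hqK hqy).1
    have e := ae_restrict_of_ae (s := Ω) (ae_ellipticIntegrand_eq φ B fun z => p z + q z)
    exact ⟨(hv.integrableOn_ellipticIntegrand h hΩ hB).congr e,
      (hi _ hv).trans_eq (integral_congr_ae e)⟩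

end Equivalence

end FunctionalDissipativity

theorem mainTheorem8 (φ : ℝ → ℝ) (hφ : FunctionalDissipativity.Admissible φ)
    (hΛ : FunctionalDissipativity.LamInftySq φ < 1)
    (m : ℕ) (a b : EReal) (hab : a < b)
    (A : ℝ → Matrix (Fin m) (Fin m) ℂ)
    (hA : ∀ i j, MeasureTheory.LocallyIntegrableOn (fun x => A x i j)
      (FunctionalDissipativity.interval a b)) :
    List.TFAE [
      FunctionalDissipativity.StrictDissipative φ (FunctionalDissipativity.interval a b) A,
      ∃ κ : ℝ, 0 < κ ∧ FunctionalDissipativity.Dissipative φ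
        (FunctionalDissipativity.interval a b)
        (fun x => A x - κ • (1 : Matrix (Fin m) (Fin m) ℂ)),
      FunctionalDissipativity.StrongElliptic φ (FunctionalDissipativity.interval a b) A,
      FunctionalDissipativity.IntegralElliptic φ (FunctionalDissipativity.interval a b) A,
      FunctionalDissipativity.WeakElliptic φ (FunctionalDissipativity.interval a b) A] := by
  have hΩ := FunctionalDissipativity.isOpen_interval a b
  tfae_have 1 → 2 := fun h => h.dissipative_sub hφ hΛ hΩ hA
  tfae_have 2 → 3 := fun ⟨κ, hκ, h⟩ =>
    (h.pointwiseNonneg hφ hΩ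
      (FunctionalDissipativity.locallyIntegrableOn_entries_sub_smul_one hA κ)).strongElliptic
      hφ hΛ hκ
  tfae_have 3 → 1 := fun h => h.strictDissipative hφ hΩ hA
  tfae_have 3 → 4 := fun h => h.integralElliptic hφ hΩ hA
  tfae_have 4 → 3 := fun h => by
    obtain ⟨κ, hκ, hi⟩ := h.exists_integral_nonneg hφ hΩ hA
    exact (FunctionalDissipativity.pointwiseNonneg_of_integral_nonneg hφ hΩ
      (FunctionalDissipativity.locallyIntegrableOn_entries_sub_smul_one hA κ) hi).strongElliptic
      hφ hΛ hκ
  tfae_have 5 ↔ 3 := FunctionalDissipativity.weakElliptic_iff_strongElliptic φ _ A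
  tfae_finish
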